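/- **Conventions.** For a finite connected graph $G$ with node set $V$, a *tube* is a proper non-empty set $t\subsetneq V$ of nodes whose induced graph is connected. The *graph associahedron* $P_G$ is the convex polytope sculpted from the simplex $\Delta_G=\{x\in\mathbb R^V: x_v\ge 0,\ \sum_{v} x_v=1\}$, whose facets $x_v=0$ are labelled by the nodes, by truncating, for every tube $t$, the face $\{x_v=0 \text{ for all } v\in t\}$: $$P_G=P_{G,c}=\Big\{x\in\Delta_G:\ \sum_{v\in t}x_v\ge c_t\ \text{ for every tube } t\Big\}.$$ Here $c$ is any system of truncation depths, that is, of real numbers $c_t\ge 0$ for the tubes $t$, together with $c_V=1$, such that $c_{t_1}+c_{t_2}<c_{t_1\cup t_2}$ whenever $t_1,t_2$ are tubes, neither contained in the other, whose union induces a connected graph. Given a set of hypersurfaces, of which some pairs are disjoint, the associated *abstract polytope* has one face of codimension $d$ for every set of $d$ pairwise disjoint hypersurfaces, inclusion of faces being dual to inclusion of sets. We say that it *is the graph associahedron of* $G$ if truncation depths for $G$ exist and, for every choice $c$ of them, there is an isomorphism from its poset of faces to the poset of non-empty faces of $P_{G,c}$ (including $P_{G,c}$ itself) ordered by inclusion,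 which takes each set of $d$ pairwise disjoint hypersurfaces to a face of dimension $|V|-1-d$. **Hypersurfaces of a lattice.** A vertex of a lattice is *internal* if it is neither the initial nor the terminal vertex. * For $\{0,1,\infty\}^m\times\{0,1\}^k$ (product order, $0<1<\infty$), the hypersurfaces are the internal hypersurfaces $Y_I$, one for each internal vertex $I=(m_1,\dots,m_{m+k})$, and the auxiliary hypersurfaces $S_1,\dots,S_m$. Distinct $Y_I,Y_J$ are disjoint if and only if $I<J$ or $J<I$; $Y_I$ and $S_i$ are disjoint if and only if $m_i\ne 1$; the $S_i$ are pairwise disjoint. Let $P_{m,k}$ be the associated abstract polytope. * For $\{0,\dots,n_1\}\times\dots\times\{0,\dots,n_l\}$ (product order), the hypersurfaces are the internal hypersurfaces $Y_I$, one for each internal vertex $I=(I_1,\dots,I_l)$, and for each $1\le i\le l$ the auxiliary hypersurfaces $S^{j}_{k}(i)$ with $1\le j<k\le n_i$. Distinct $Y_I,Y_J$ are disjoint if and only if $I<J$ or $J<I$; $Y_I$ and $S^j_k(i)$ intersect if and only if $j\le I_i<k$; distinct $S^j_k(i)$ and $S^{j'}_{k'}(i')$ intersect if and only if $i=i'$ and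 the intervals $\{j,\dots,k\}$ and $\{j',\dots,k'\}$ overlap but are not nested. **Theorem.** 1. Let $m,k\ge 0$ with $m+k\ge1$. The polytope $P_{m,k}$ associated to the lattice $\{0,1,\infty\}^m\times\{0,1\}^k$ is the graph associahedron of the $(m+k)$-clique with $m$ leaves, one attached to each of $m$ distinct nodes of the clique. In particular its faces of codimension $d$ correspond to the sets of $d$ pairwise disjoint internal and auxiliary hypersurfaces. 2. More generally, let $l\ge1$ and $n_1,\dots,n_l\ge 1$. The abstract polytope associated to the lattice $\{0,\dots,n_1\}\times\dots\times\{0,\dots,n_l\}$ is the graph associahedron of the $l$-clique with paths of lengths $n_1-1,\dots,n_l-1$ attached to its $l$ nodes (so that the graph has $n_1+\dots+n_l$ nodes). -/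

import Mathlib

/-! ### Graph associahedra -/

section GraphAssociahedron

variable {V : Type*}

/-- The set of nodes `t` is non-empty and its induced graph is connected. -/
def IsConnectedSet (G : SimpleGraph V) (t : Finset V) : Prop :=
  (G.induce (t : Set V)).Connected

/-- A tube of `G`: a proper, non-empty set of nodes whose induced graph is connected. -/
def IsTube [Fintype V] (G : SimpleGraph V) (t : Finset V) : Prop :=
  t ≠ Finset.univ ∧ IsConnectedSet G t

/-- Depths at which the faces of the simplex are truncated, the face of a tube `t` being the
one on which the coordinates in `t` vanish. Smaller faces (larger tubes) have to be cut more
deeply: whenever two tubes, neither containing the other, intersect or are adjacent (that is,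
whenever their union is connected; it may be the whole graph, to which the total mass `1` of
the simplex is assigned), the cut at the union is deeper than the two cuts together. -/
structure IsTruncationDepth [Fintype V] [DecidableEq V] (G : SimpleGraph V)
    (c : Finset V → ℝ) : Prop where
  nonneg : ∀ t, IsTube G t → 0 ≤ c t
  total : c Finset.univ = 1
  add_lt : ∀ t₁ t₂, IsTube G t₁ → IsTube G t₂ → ¬ t₁ ⊆ t₂ → ¬ t₂ ⊆ t₁ →
    IsConnectedSet G (t₁ ∪ t₂) → c t₁ + c t₂ < c (t₁ ∪ t₂)

/-- The graph associahedron of `G`, sculpted from the simplex whose facets `x v = 0` are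
labelled by the nodes of `G`, by truncating the face of each tube `t` at depth `c t`. -/
def graphAssociahedron [Fintype V] (G : SimpleGraph V) (c : Finset V → ℝ) : Set (V → ℝ) :=
  {x | x ∈ stdSimplex ℝ V ∧ ∀ t, IsTube G t → c t ≤ ∑ v ∈ t, x v}

/-- The non-empty faces of a convex set, ordered by inclusion (the set itself included). -/
abbrev PolytopeFace {E : Type*} [AddCommGroup E] [Module ℝ E] [TopologicalSpace E]
    (P : Set E) : Type _ :=
  {F : Set E // F.Nonempty ∧ IsExposed ℝ P F}

end GraphAssociahedron

/-! ### Abstract polytopes of disjoint hypersurfaces -/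

/-- Let `D` be the graph whose nodes are hypersurfaces, two of them being joined when they are
disjoint. The associated abstract polytope is given by its poset of faces: one face for each
set of pairwise disjoint hypersurfaces, inclusion of faces being dual to inclusion of sets. -/
abbrev DisjointnessPolytope {α : Type*} (D : SimpleGraph α) : Type _ :=
  {S : Finset α // D.IsClique (S : Set α)}ᵒᵈ

/-- The number of hypersurfaces of a face, that is, its codimension. -/
def DisjointnessPolytope.codim {α : Type*} {D : SimpleGraph α}
    (F : DisjointnessPolytope D) : ℕ :=
  (OrderDual.ofDual F).1.card

/-- The internal vertices of a bounded lattice: all but the initial and the terminal one. -/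
abbrev InternalVertex (L : Type*) [PartialOrder L] [BoundedOrder L] : Type _ :=
  {I : L // I ≠ ⊥ ∧ I ≠ ⊤}

/-! ### The lattice `{0,1,∞}^m × {0,1}^k` -/

/-- The lattice `{0,1,∞}^m × {0,1}^k`, with `0 < 1 < ∞` written as `0 < 1 < 2`. -/
abbrev CubeLattice (m k : ℕ) : Type := (Fin m → Fin 3) × (Fin k → Fin 2)

/-- The internal hypersurfaces `Y_I` and the auxiliary hypersurfaces `S_i`, `1 ≤ i ≤ m`. -/
inductive CubeHypersurface (m k : ℕ) : Type
  | Y (I : InternalVertex (CubeLattice m k))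
  | S (i : Fin m)

/-- Disjointness of distinct hypersurfaces: `Y_I` and `Y_J` are disjoint when `I` and `J` are
ordered, `Y_I` and `S_i` are disjoint when the digit `m_i` of `I` is not `1`, and the `S_i` are
pairwise disjoint. -/
def CubeHypersurface.graph (m k : ℕ) : SimpleGraph (CubeHypersurface m k) where
  Adj
    | .Y I, .Y J => I < J ∨ J < I
    | .Y I, .S i => I.1.1 i ≠ 1
    | .S i, .Y I => I.1.1 i ≠ 1
    | .S i, .S j => i ≠ j
  symm := ⟨by
    rintro (I | i) (J | j) h
    · exact h.symm
    · exact h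
    · exact h
    · exact Ne.symm h⟩
  loopless := ⟨by
    rintro (I | i) h
    · exact h.elim (lt_irrefl _) (lt_irrefl _)
    · exact h rfl⟩

/-- The nodes of the `(m+k)`-clique with `m` leaves: first the nodes of the clique, then the
leaves. -/
abbrev CliqueLeafNode (m k : ℕ) : Type := (Fin m ⊕ Fin k) ⊕ Fin m

/-- The `(m+k)`-clique with `m` leaves, one at each of the first `m` nodes of the clique. -/
def cliqueWithLeaves (m k : ℕ) : SimpleGraph (CliqueLeafNode m k) where
  Adj
    | .inl a, .inl b => a ≠ b
    | .inl a, .inr i => a = Sum.inl i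
    | .inr i, .inl a => a = Sum.inl i
    | .inr _, .inr _ => False
  symm := ⟨by
    rintro (a | i) (b | j) h
    · exact Ne.symm h
    · exact h
    · exact h
    · exact h⟩
  loopless := ⟨by
    rintro (a | i) h
    · exact h rfl
    · exact h⟩

/-! ### Products of chains `{0,…,n_1} × ⋯ × {0,…,n_l}` -/

/-- The lattice `{0,…,n_1} × ⋯ × {0,…,n_l}` with the product order. -/
abbrev ChainLattice {l : ℕ} (n : Fin l → ℕ) : Type := (i : Fin l) → Fin (n i + 1)

/-- The internal hypersurfaces `Y_I`, and for each of the `l` stacks of handles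
`h_1, …, h_{n_i}` the auxiliary hypersurfaces `S^j_k`, `1 ≤ j < k ≤ n_i`, where `S^j_k` lies
between the handles `h_j` and `h_k` of the stack. -/
inductive ChainHypersurface {l : ℕ} (n : Fin l → ℕ) : Type
  | Y (I : InternalVertex (ChainLattice n))
  | S (i : Fin l) (j k : ℕ) (one_le : 1 ≤ j) (lt : j < k) (le : k ≤ n i)

/-- Disjointness of distinct hypersurfaces: `Y_I` and `Y_J` are disjoint when `I` and `J` are
ordered; `Y_I` and the hypersurface `S^j_k` of the `i`-th stack intersect when `j ≤ I i < k`;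
auxiliary hypersurfaces of distinct stacks are disjoint, and `S^j_k` and `S^{j'}_{k'}` in the
same stack intersect when the intervals `{j,…,k}` and `{j',…,k'}` overlap but are not nested. -/
def ChainHypersurface.graph {l : ℕ} (n : Fin l → ℕ) : SimpleGraph (ChainHypersurface n) where
  Adj
    | .Y I, .Y J => I < J ∨ J < I
    | .Y I, .S i j k _ _ _ => ¬ (j ≤ (I.1 i : ℕ) ∧ (I.1 i : ℕ) < k)
    | .S i j k _ _ _, .Y I => ¬ (j ≤ (I.1 i : ℕ) ∧ (I.1 i : ℕ) < k)
    | .S i j k _ _ _, .S i' j' k' _ _ _ =>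
        (i, j, k) ≠ (i', j', k') ∧
          (i = i' → Disjoint (Finset.Icc j k) (Finset.Icc j' k') ∨
            Finset.Icc j k ⊆ Finset.Icc j' k' ∨ Finset.Icc j' k' ⊆ Finset.Icc j k)
  symm := ⟨by
    rintro (I | ⟨i, j, k, _, _, _⟩) (J | ⟨i', j', k', _, _, _⟩) h
    · exact h.symm
    · exact h
    · exact h
    · exact ⟨h.1.symm, fun e => (h.2 e.symm).imp (fun d => d.symm) Or.symm⟩⟩
  loopless := ⟨by
    rintro (I | ⟨i, j, k, _, _, _⟩) h
    · exact h.elim (lt_irrefl _) (lt_irrefl _)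
    · exact h.1 rfl⟩

/-- The nodes of the `l`-clique with paths attached: the `i`-th node of the clique is `(i, 0)`,
and the path attached to it runs through `(i, 1), …, (i, n_i - 1)`. -/
abbrev CliquePathNode {l : ℕ} (n : Fin l → ℕ) : Type := (i : Fin l) × Fin (n i)

/-- The `l`-clique with paths of lengths `n_1 - 1, …, n_l - 1` attached to its nodes. -/
def cliqueWithPaths {l : ℕ} (n : Fin l → ℕ) : SimpleGraph (CliquePathNode n) where
  Adj u v :=
    (u.1 ≠ v.1 ∧ (u.2 : ℕ) = 0 ∧ (v.2 : ℕ) = 0) ∨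
      (u.1 = v.1 ∧ ((u.2 : ℕ) + 1 = v.2 ∨ (v.2 : ℕ) + 1 = u.2))
  symm := ⟨by
    rintro u v (⟨h, hu, hv⟩ | ⟨h, h'⟩)
    · exact Or.inl ⟨h.symm, hv, hu⟩
    · exact Or.inr ⟨h.symm, h'.symm⟩⟩
  loopless := ⟨by
    rintro u (⟨h, -⟩ | ⟨-, h | h⟩)
    · exact h rfl
    · omega
    · omega⟩

/-! ### Realization of an abstract polytope -/

/-- The abstract polytope of `D` is the graph associahedron of `G`: the graph associahedron
exists and, however deep the truncations, its poset of non-empty faces is isomorphic to that of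
the abstract polytope, by an isomorphism under which a set of `d` hypersurfaces corresponds to a
face of codimension `d` in the dimension `|V| - 1` of the simplex. -/
def IsGraphAssociahedronOf {α V : Type*} [Fintype V] [DecidableEq V]
    (D : SimpleGraph α) (G : SimpleGraph V) : Prop :=
  (∃ c, IsTruncationDepth G c) ∧
    ∀ c, IsTruncationDepth G c →
      ∃ e : DisjointnessPolytope D ≃o PolytopeFace (graphAssociahedron G c),
        ∀ F, Module.finrank ℝ (vectorSpan ℝ (e F).1) + F.codim + 1 = Fintype.card V

/-! ### Connected sets of nodes -/

namespace SimpleGraph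

variable {V : Type*} {G : SimpleGraph V}

/-! The proof has a geometric half, valid for every connected graph, and a combinatorial half,
special to cliques with paths. Call two connected sets compatible if they are nested or their union
is disconnected.

Geometry. If incompatible tubes `s`, `t` were both tight at a point of the polytope, the sum of its
coordinates over `s ∪ t` would be at most `c s + c t < c (s ∪ t)`, which is impossible; so tubes
tight at a common point are compatible. Conversely, a compatible family extends to a maximal one,
`N`, containing the set of all nodes. Sending a node to the smallest member of `N` containing it is
a bijection onto `N`, so the sums over the members of `N` satisfy a triangular system and can be
prescribed (`exists_sum_eq`). When they are prescribed to be the depths, superadditivity makes the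
solution nonnegative and all other tubes slack (`nonneg_of_sum_eq`, `le_sum_and_lt_sum`). Slightly
raising the depths at the unwanted members of `N` then yields a point at which exactly the given
tubes are tight (`exists_tubeSum_eq_iff`). Hence faces correspond to compatible families, and
codimensions to their sizes because the sums are independent.

Combinatorics. A connected set meeting the clique consists of initial segments of the paths, whose
lengths are the coordinates of a lattice vertex; one missing the clique is a segment of a single
path, that is, an auxiliary hypersurface (`exists_stackTube_eq`). Two tubes of the first kind have
connected union, so for them compatibility is comparability of vertices; the remaining cases compare
intervals. -/

theorem isConnectedSet_singleton (v : V) : IsConnectedSet G {v} := by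
  unfold IsConnectedSet
  rw [Finset.coe_singleton]
  have : Subsingleton ({v} : Set V) := inferInstance
  exact { preconnected := Preconnected.of_subsingleton, nonempty := ⟨⟨v, rfl⟩⟩ }

theorem _root_.IsConnectedSet.nonempty {t : Finset V} (h : IsConnectedSet G t) : t.Nonempty := by
  obtain ⟨⟨v, hv⟩⟩ := Connected.nonempty h
  exact ⟨v, hv⟩

theorem isConnectedSet_univ [Fintype V] (h : G.Connected) : IsConnectedSet G Finset.univ := by
  unfold IsConnectedSet
  rw [Finset.coe_univ]
  exact (induceUnivIso G).connected_iff.2 h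

theorem _root_.IsConnectedSet.exists_adj {t : Finset V} (h : IsConnectedSet G t) {s : Set V}
    {a b : V} (ha : a ∈ t) (has : a ∈ s) (hb : b ∈ t) (hbs : b ∉ s) :
    ∃ u ∈ t, u ∈ s ∧ ∃ v ∈ t, v ∉ s ∧ G.Adj u v := by
  obtain ⟨p⟩ := h.preconnected ⟨a, ha⟩ ⟨b, hb⟩
  obtain ⟨d, -, h1, h2⟩ := p.exists_boundary_dart {x | x.1 ∈ s} has hbs
  exact ⟨d.fst.1, d.fst.2, h1, d.snd.1, d.snd.2, h2, d.adj⟩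

/-- A set of nodes is connected when every one of its nodes can be reached from a given one, in
the sense that every set containing the given node but not the whole set has an edge leaving
it. -/
theorem isConnectedSet_of_exists_adj {t : Finset V} {a : V} (ha : a ∈ t)
    (h : ∀ s : Set V, a ∈ s → s ⊆ t → ∀ b ∈ t, b ∉ s → ∃ u ∈ s, ∃ v ∈ t, v ∉ s ∧ G.Adj u v) :
    IsConnectedSet G t := by
  unfold IsConnectedSet
  rw [connected_iff_exists_forall_reachable]
  refine ⟨⟨a, ha⟩, ?_⟩
  by_contra! hcon
  obtain ⟨⟨b, hb⟩, hab⟩ := hcon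
  obtain ⟨u, ⟨hut, hu⟩, v, hv, hvs, huv⟩ :=
    h {x | ∃ hx : x ∈ t, (G.induce (t : Set V)).Reachable ⟨a, ha⟩ ⟨x, hx⟩}
      ⟨ha, Reachable.refl _⟩ (fun x hx => hx.1) b hb (fun hx => hab hx.2)
  refine hvs ⟨hv, hu.trans (Adj.reachable ?_)⟩
  exact huv

variable [DecidableEq V]

theorem _root_.IsConnectedSet.union_of_mem {s t : Finset V} (hs : IsConnectedSet G s)
    (ht : IsConnectedSet G t) {a : V} (has : a ∈ s) (hat : a ∈ t) :
    IsConnectedSet G (s ∪ t) := by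
  unfold IsConnectedSet
  rw [Finset.coe_union]
  exact induce_union_connected hs.preconnected ht.preconnected ⟨a, has, hat⟩

theorem _root_.IsConnectedSet.union_of_adj {s t : Finset V} (hs : IsConnectedSet G s)
    (ht : IsConnectedSet G t) {a b : V} (has : a ∈ s) (hbt : b ∈ t) (hab : G.Adj a b) :
    IsConnectedSet G (s ∪ t) := by
  unfold IsConnectedSet
  rw [Finset.coe_union]
  exact connected_induce_union hs.preconnected ht.preconnected has hbt hab

/-- Two sets of nodes are compatible if they are nested or if their union is disconnected. -/
def TubeCompatible (G : SimpleGraph V) (s t : Finset V) : Prop :=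
  s ⊆ t ∨ t ⊆ s ∨ ¬ IsConnectedSet G (s ∪ t)

theorem TubeCompatible.symm {s t : Finset V} (h : TubeCompatible G s t) :
    TubeCompatible G t s := by
  unfold TubeCompatible at *
  rw [Finset.union_comm]
  tauto

theorem TubeCompatible.subset_or_subset {s t : Finset V} (h : TubeCompatible G s t)
    (hst : IsConnectedSet G (s ∪ t)) : s ⊆ t ∨ t ⊆ s := by
  unfold TubeCompatible at h
  tauto

/-! ### Nested families of connected sets -/

/-- `s` is a maximal member of `N` strictly contained in `t`. -/
structure IsNestedChild (N : Finset (Finset V)) (s t : Finset V) : Prop where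
  mem : s ∈ N
  ssubset : s ⊂ t
  eq_of_subset : ∀ r ∈ N, s ⊆ r → r ⊂ t → r = s

theorem exists_isNestedChild_of_ssubset {N : Finset (Finset V)} {r t : Finset V} (hr : r ∈ N)
    (hrt : r ⊂ t) : ∃ s, r ⊆ s ∧ IsNestedChild N s t := by
  obtain ⟨s, hs, hmax⟩ := Finset.exists_max_image (N.filter fun s => r ⊆ s ∧ s ⊂ t) Finset.card
    ⟨r, Finset.mem_filter.2 ⟨hr, Finset.Subset.refl _, hrt⟩⟩
  have hs' := Finset.mem_filter.1 hs
  refine ⟨s, hs'.2.1, hs'.1, hs'.2.2, fun q hq hsq hqt => ?_⟩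
  exact (Finset.eq_of_subset_of_card_le hsq
    (hmax q (Finset.mem_filter.2 ⟨hq, hs'.2.1.trans hsq, hqt⟩))).symm

variable [Fintype V]

/-- A family of pairwise compatible connected sets of nodes, the set of all nodes among them. -/
structure IsNestedFamily (G : SimpleGraph V) (N : Finset (Finset V)) : Prop where
  univ_mem : Finset.univ ∈ N
  connected : ∀ t ∈ N, IsConnectedSet G t
  compatible : ∀ s ∈ N, ∀ t ∈ N, TubeCompatible G s t

/-- The smallest member of a nested family containing a given set of nodes. -/
def nestedHull (N : Finset (Finset V)) (u : Finset V) : Finset V :=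
  (N.filter (u ⊆ ·)).inf id

theorem subset_nestedHull (N : Finset (Finset V)) (u : Finset V) : u ⊆ nestedHull N u :=
  Finset.le_inf fun _ hs => (Finset.mem_filter.1 hs).2

theorem nestedHull_subset {N : Finset (Finset V)} {u s : Finset V} (hs : s ∈ N) (hu : u ⊆ s) :
    nestedHull N u ⊆ s :=
  Finset.inf_le (f := id) (Finset.mem_filter.2 ⟨hs, hu⟩)

namespace IsNestedFamily

variable {N : Finset (Finset V)}

theorem subset_or_subset_of_mem (hN : IsNestedFamily G N) {s t : Finset V} (hs : s ∈ N)
    (ht : t ∈ N) {a : V} (has : a ∈ s) (hat : a ∈ t) : s ⊆ t ∨ t ⊆ s :=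
  (hN.compatible s hs t ht).subset_or_subset
    ((hN.connected s hs).union_of_mem (hN.connected t ht) has hat)

theorem subset_or_subset_of_adj (hN : IsNestedFamily G N) {s t : Finset V} (hs : s ∈ N)
    (ht : t ∈ N) {a b : V} (has : a ∈ s) (hbt : b ∈ t) (hab : G.Adj a b) : s ⊆ t ∨ t ⊆ s :=
  (hN.compatible s hs t ht).subset_or_subset
    ((hN.connected s hs).union_of_adj (hN.connected t ht) has hbt hab)

/-- The members containing a given node form a chain, so the intersection of those containing `u` is
the smallest of them. -/
theorem nestedHull_mem (hN : IsNestedFamily G N) {u : Finset V} (hu : u.Nonempty) :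
    nestedHull N u ∈ N := by
  obtain ⟨a, ha⟩ := hu
  obtain ⟨m, hm, hmin⟩ := Finset.exists_min_image (N.filter (u ⊆ ·)) Finset.card
    ⟨Finset.univ, Finset.mem_filter.2 ⟨hN.univ_mem, Finset.subset_univ _⟩⟩
  have hm' := Finset.mem_filter.1 hm
  have : nestedHull N u = m := by
    refine Finset.Subset.antisymm (nestedHull_subset hm'.1 hm'.2) (Finset.le_inf fun s hs => ?_)
    have hs' := Finset.mem_filter.1 hs
    rcases hN.subset_or_subset_of_mem hm'.1 hs'.1 (hm'.2 ha) (hs'.2 ha) with h | h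
    · exact h
    · exact (Finset.eq_of_subset_of_card_le h (hmin s hs)).ge
  exact this ▸ hm'.1

theorem exists_isNestedChild (hN : IsNestedFamily G N) {t : Finset V} (ht : t ∈ N) {w : V}
    (hw : w ∈ t) (hne : nestedHull N {w} ≠ t) : ∃ s, w ∈ s ∧ IsNestedChild N s t := by
  obtain ⟨s, hs, h⟩ := exists_isNestedChild_of_ssubset
    (hN.nestedHull_mem (Finset.singleton_nonempty w))
    (Finset.ssubset_iff_subset_ne.2
      ⟨nestedHull_subset ht (Finset.singleton_subset_iff.2 hw), hne⟩)
  exact ⟨s, hs (subset_nestedHull N {w} (Finset.mem_singleton_self w)), h⟩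

/-- An edge leaving a child of `t` within `t` ends at a node contained in no child of `t`. -/
theorem nestedHull_eq_of_adj (hN : IsNestedFamily G N) {s t : Finset V} (ht : t ∈ N)
    (hs : IsNestedChild N s t) {a b : V} (ha : a ∈ s) (hb : b ∈ t) (hbs : b ∉ s)
    (hab : G.Adj a b) : nestedHull N {b} = t := by
  by_contra hne
  obtain ⟨r, hbr, hr⟩ := hN.exists_isNestedChild ht hb hne
  rcases hN.subset_or_subset_of_adj hs.mem hr.mem ha hbr hab with h | h
  · exact hbs (hs.eq_of_subset r hr.mem h hr.ssubset ▸ hbr)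
  · exact hbs (h hbr)

/-- If the children of `t` covered it, an edge leaving one of them within `t` would still end
outside all of them. The node found acts as the root of `t`. -/
theorem exists_nestedHull_eq (hN : IsNestedFamily G N) {t : Finset V} (ht : t ∈ N) :
    ∃ v ∈ t, nestedHull N {v} = t := by
  by_contra! hcon
  obtain ⟨w, hw⟩ := (hN.connected t ht).nonempty
  obtain ⟨s, hws, hs⟩ := hN.exists_isNestedChild ht hw (hcon w hw)
  obtain ⟨z, hzt, hzs⟩ := Finset.exists_of_ssubset hs.ssubset
  obtain ⟨a, -, has, b, hbt, hbs, hab⟩ :=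
    (hN.connected t ht).exists_adj (s := s) hw hws hzt hzs
  exact hcon b hbt (hN.nestedHull_eq_of_adj ht hs has hbt hbs hab)

end IsNestedFamily

/-- A nested family to which no connected set can be added. -/
structure IsMaximalNestedFamily (G : SimpleGraph V) (N : Finset (Finset V)) : Prop
    extends IsNestedFamily G N where
  mem_of_compatible : ∀ u, IsConnectedSet G u → (∀ s ∈ N, TubeCompatible G u s) → u ∈ N

theorem IsNestedFamily.exists_maximal {N : Finset (Finset V)} (hN : IsNestedFamily G N) :
    ∃ M, N ⊆ M ∧ IsMaximalNestedFamily G M := by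
  classical
  obtain ⟨M, hM, hmax⟩ := Finset.exists_max_image
    ((Finset.univ : Finset (Finset (Finset V))).filter fun M => N ⊆ M ∧ IsNestedFamily G M)
    Finset.card ⟨N, by simpa using hN⟩
  simp only [Finset.mem_filter, Finset.mem_univ, true_and] at hM hmax
  refine ⟨M, hM.1, ⟨hM.2, fun u hu hc => ?_⟩⟩
  by_contra hne
  have h := hmax (insert u M) ⟨hM.1.trans (Finset.subset_insert _ _),
    ⟨Finset.mem_insert_of_mem hM.2.univ_mem, ?_, ?_⟩⟩
  · rw [Finset.card_insert_of_notMem hne] at h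
    omega
  · intro t ht
    rcases Finset.mem_insert.1 ht with rfl | ht
    exacts [hu, hM.2.connected t ht]
  · intro s hs t ht
    rcases Finset.mem_insert.1 hs with rfl | hs' <;> rcases Finset.mem_insert.1 ht with rfl | ht'
    exacts [Or.inl subset_rfl, hc t ht', (hc s hs').symm, hM.2.compatible s hs' t ht']

/-! ### Maximal nested families and the vertices of the polytope -/

namespace IsMaximalNestedFamily

variable {N : Finset (Finset V)}

/-- Each member has only one root: with two roots `v` and `w`, the component of `w` in `t` without
`v` could be added to the family, and it would be a smaller member containing `w`. -/
theorem nestedHull_singleton_injective (hN : IsMaximalNestedFamily G N) :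
    Function.Injective fun v : V => nestedHull N {v} := by
  classical
  intro v w hvw
  by_contra hne
  set t := nestedHull N {v} with hv
  have hw : t = nestedHull N {w} := hvw
  have ht : t ∈ N := hN.nestedHull_mem (Finset.singleton_nonempty v)
  have hvt : v ∈ t := subset_nestedHull N {v} (Finset.mem_singleton_self v)
  have hwt : w ∈ t := hw ▸ subset_nestedHull N {w} (Finset.mem_singleton_self w)
  obtain ⟨C, hC, hmax⟩ := Finset.exists_max_image
    ((Finset.univ : Finset (Finset V)).filter
      fun C => IsConnectedSet G C ∧ w ∈ C ∧ C ⊆ t.erase v) Finset.card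
    ⟨{w}, by simp [isConnectedSet_singleton, hwt, Ne.symm hne]⟩
  simp only [Finset.mem_filter, Finset.mem_univ, true_and] at hC hmax
  obtain ⟨hCc, hwC, hCt⟩ := hC
  have hCt' : C ⊆ t := hCt.trans (Finset.erase_subset _ _)
  have hmem : C ∈ N := by
    refine hN.mem_of_compatible C hCc fun s hs => ?_
    by_cases hconn : IsConnectedSet G (C ∪ s)
    swap
    · exact Or.inr (Or.inr hconn)
    -- If `s` lies in `t` and avoids `v`, maximality of the component `C` absorbs `s`. If `t ∪ s`
    -- were disconnected, `C ∪ s` could not be connected, because `C` is a part of `t`.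
    rcases hN.compatible t ht s hs with h | h | h
    · exact Or.inl (hCt'.trans h)
    · by_cases hvs : v ∈ s
      · exact Or.inl (hCt'.trans (nestedHull_subset hs (Finset.singleton_subset_iff.2 hvs)))
      · have h1 : C ∪ s ⊆ t.erase v := Finset.union_subset hCt
          fun x hx => Finset.mem_erase.2 ⟨fun hxv => hvs (hxv ▸ hx), h hx⟩
        have h2 := Finset.eq_of_subset_of_card_le Finset.subset_union_left
          (hmax (C ∪ s) ⟨hconn, Finset.mem_union_left _ hwC, h1⟩)
        exact Or.inr (Or.inl (h2 ▸ Finset.subset_union_right))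
    · refine absurd ?_ h
      have := (hN.connected t ht).union_of_mem hconn hwt (Finset.mem_union_left _ hwC)
      rwa [← Finset.union_assoc, Finset.union_eq_left.2 hCt'] at this
  have : v ∈ C := (hw ▸ nestedHull_subset hmem (Finset.singleton_subset_iff.2 hwC) : t ⊆ C) hvt
  exact Finset.notMem_erase v t (hCt this)

/-- The sums over the members of a maximal nested family can be prescribed. -/
theorem exists_sum_eq (hN : IsMaximalNestedFamily G N) (c : Finset V → ℝ) :
    ∃ x : V → ℝ, ∀ t ∈ N, ∑ v ∈ t, x v = c t := by
  have hlt : ∀ v w : V, w ∈ (nestedHull N {v}).erase v →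
      (nestedHull N {w}).card < (nestedHull N {v}).card := by
    intro v w hw
    obtain ⟨hne, hw⟩ := Finset.mem_erase.1 hw
    refine Finset.card_lt_card (Finset.ssubset_iff_subset_ne.2 ⟨?_, ?_⟩)
    · exact nestedHull_subset (hN.nestedHull_mem (Finset.singleton_nonempty v))
        (Finset.singleton_subset_iff.2 hw)
    · exact fun h => hne (hN.nestedHull_singleton_injective h)
  -- The system is triangular: the other nodes of the hull of `v` have strictly smaller hulls, so
  -- the equation of this hull determines `x v` from values already known.
  let x : V → ℝ := (measure fun v : V => (nestedHull N {v}).card).wf.fix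
    fun v ih => c (nestedHull N {v}) -
      ∑ w ∈ ((nestedHull N {v}).erase v).attach, ih w.1 (hlt v w.1 w.2)
  have hx : ∀ v, x v = c (nestedHull N {v}) - ∑ w ∈ (nestedHull N {v}).erase v, x w := by
    intro v
    rw [← Finset.sum_attach]
    exact WellFounded.fix_eq _ _ v
  refine ⟨x, fun t ht => ?_⟩
  obtain ⟨v, hv, rfl⟩ := hN.exists_nestedHull_eq ht
  rw [← Finset.add_sum_erase _ _ hv, hx v]
  ring

variable {c : Finset V → ℝ} {x : V → ℝ}

/-- An edge leaving the child `s` within its parent must end at the root, so every child is adjacent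
to `v`. -/
theorem union_isConnectedSet (hN : IsMaximalNestedFamily G N) {v : V} {s u : Finset V}
    (hs : IsNestedChild N s (nestedHull N {v})) (hu : IsConnectedSet G u) (hv : v ∈ u) :
    IsConnectedSet G (u ∪ s) := by
  set t := nestedHull N {v} with htv
  have ht : t ∈ N := hN.nestedHull_mem (Finset.singleton_nonempty v)
  have hvt : v ∈ t := subset_nestedHull N {v} (Finset.mem_singleton_self v)
  have hvs : v ∉ s := fun h => hs.ssubset.2
    (nestedHull_subset hs.mem (Finset.singleton_subset_iff.2 h))
  obtain ⟨z, hz⟩ := (hN.connected s hs.mem).nonempty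
  obtain ⟨a, -, has, b, hbt, hbs, hab⟩ :=
    (hN.connected t ht).exists_adj (s := s) (hs.ssubset.1 hz) hz hvt hvs
  have hb := hN.nestedHull_eq_of_adj ht hs has hbt hbs hab
  have hbv : b = v := hN.nestedHull_singleton_injective hb
  subst hbv
  exact hu.union_of_adj (hN.connected s hs.mem) hv has hab.symm

/-- The coordinate at the root of `t` is `c t` minus the depths of the children of `t`. Joining the
children to the root one at a time and using superadditivity at each union shows that this is
nonnegative. -/
theorem nonneg_of_sum_eq (hN : IsMaximalNestedFamily G N) (hc : IsTruncationDepth G c)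
    (hx : ∀ t ∈ N, ∑ v ∈ t, x v = c t) (v : V) : 0 ≤ x v := by
  classical
  set t := nestedHull N {v} with htv
  have ht : t ∈ N := hN.nestedHull_mem (Finset.singleton_nonempty v)
  have hvt : v ∈ t := subset_nestedHull N {v} (Finset.mem_singleton_self v)
  have hnot : ∀ s ∈ N, s ⊂ t → v ∉ s := fun s hs hst h => hst.2
    (nestedHull_subset hs (Finset.singleton_subset_iff.2 h))
  -- `A` stands for the root with some of the children: the condition on `s` excludes members below
  -- `t` that are met only partially. For `A = t` the last condition reads `c t - x v ≤ c t`.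
  obtain ⟨A, hA, hmax⟩ := Finset.exists_max_image
    ((Finset.univ : Finset (Finset V)).filter fun A => IsConnectedSet G A ∧ v ∈ A ∧ A ⊆ t ∧
      (∀ s ∈ N, s ⊂ t → ∀ z ∈ s, z ∈ A → s ⊆ A) ∧ ∑ w ∈ A.erase v, x w ≤ c A) Finset.card
    ⟨{v}, by
      simp only [Finset.mem_filter, Finset.mem_univ, true_and, isConnectedSet_singleton,
        Finset.mem_singleton, Finset.singleton_subset_iff, hvt, Finset.erase_singleton,
        Finset.sum_empty]
      refine ⟨fun s hs hst z hz hzv => absurd (hzv ▸ hz) (hnot s hs hst), ?_⟩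
      by_cases hu : ({v} : Finset V) = Finset.univ
      · rw [hu, hc.total]
        exact zero_le_one
      · exact hc.nonneg _ ⟨hu, isConnectedSet_singleton v⟩⟩
  simp only [Finset.mem_filter, Finset.mem_univ, true_and] at hA hmax
  obtain ⟨hAc, hvA, hAt, hAs, hsum⟩ := hA
  have hAeq : A = t := by
    by_contra hne
    obtain ⟨w, hwt, hwA⟩ := Finset.exists_of_ssubset (Finset.ssubset_iff_subset_ne.2 ⟨hAt, hne⟩)
    have hwv : w ≠ v := fun h => hwA (h ▸ hvA)
    obtain ⟨s, hws, hs⟩ := hN.exists_isNestedChild ht hwt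
      fun h => hwv (hN.nestedHull_singleton_injective h)
    have hdis : Disjoint A s := Finset.disjoint_left.2
      fun z hzA hzs => hwA (hAs s hs.mem hs.ssubset z hzs hzA hws)
    have hconn := hN.union_isConnectedSet hs hAc hvA
    have hvs := hnot s hs.mem hs.ssubset
    have hlt := hc.add_lt A s
      ⟨fun h => hne (hAt.antisymm (h ▸ Finset.subset_univ _)), hAc⟩
      ⟨fun h => hvs (h ▸ Finset.mem_univ v), hN.connected s hs.mem⟩
      (fun h => hvs (h hvA)) (fun h => hwA (h hws)) hconn
    have hcard := hmax (A ∪ s) ⟨hconn, Finset.mem_union_left _ hvA,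
      Finset.union_subset hAt hs.ssubset.1, ?_, ?_⟩
    · rw [Finset.card_union_of_disjoint hdis] at hcard
      have := Finset.card_pos.2 ⟨w, hws⟩
      omega
    · intro r hr hrt z hzr hz
      rcases Finset.mem_union.1 hz with hz | hz
      · exact (hAs r hr hrt z hzr hz).trans Finset.subset_union_left
      · rcases hN.subset_or_subset_of_mem hr hs.mem hzr hz with h | h
        · exact h.trans Finset.subset_union_right
        · exact (hs.eq_of_subset r hr h hrt).subset.trans Finset.subset_union_right
    · have h1 : (A ∪ s).erase v = A.erase v ∪ s := by
        rw [Finset.erase_union_distrib, Finset.erase_eq_of_notMem hvs]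
      rw [h1, Finset.sum_union (hdis.mono_left (Finset.erase_subset _ _)), hx s hs.mem]
      linarith
  have := Finset.add_sum_erase t x hvt
  rw [hx t ht] at this
  rw [hAeq] at hsum
  linarith

/-- Downward induction on the size of `u`. A connected `u` outside `N` contains the root of its
hull; enlarging it by a child `s` not contained in it, superadditivity and the inequality for `u ∪
s` give the strict inequality for `u`. -/
theorem le_sum_and_lt_sum (hN : IsMaximalNestedFamily G N) (hc : IsTruncationDepth G c)
    (hx : ∀ t ∈ N, ∑ v ∈ t, x v = c t) (u : Finset V) (hu : IsConnectedSet G u) :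
    c u ≤ ∑ v ∈ u, x v ∧ (u ∉ N → c u < ∑ v ∈ u, x v) := by
  induction hn : Fintype.card V - u.card using Nat.strong_induction_on generalizing u with
  | _ n ih =>
  by_cases huN : u ∈ N
  · exact ⟨(hx u huN).ge, fun h => absurd huN h⟩
  suffices c u < ∑ v ∈ u, x v from ⟨this.le, fun _ => this⟩
  have ht : nestedHull N u ∈ N := hN.nestedHull_mem hu.nonempty
  obtain ⟨r, hr, hrt⟩ := hN.exists_nestedHull_eq ht
  have hsub : u ⊆ nestedHull N {r} := hrt ▸ subset_nestedHull N u
  have hmin : ∀ s ∈ N, u ⊆ s → nestedHull N {r} ⊆ s :=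
    fun s hs hus => hrt ▸ nestedHull_subset hs hus
  rw [← hrt] at ht hr
  have hne : u ≠ nestedHull N {r} := fun h => huN (h ▸ ht)
  -- Since `u` fits into no child of its hull, it has an edge leaving a child, and such an edge ends
  -- at the root.
  have hru : r ∈ u := by
    by_contra hru
    obtain ⟨w, hw⟩ := hu.nonempty
    have hwr : w ≠ r := fun h => hru (h ▸ hw)
    obtain ⟨s, hws, hs⟩ := hN.exists_isNestedChild ht (hsub hw)
      fun h => hwr (hN.nestedHull_singleton_injective h)
    have hus : ¬ u ⊆ s := fun h => hs.ssubset.2 (hmin s hs.mem h)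
    obtain ⟨z, hzu, hzs⟩ := Finset.not_subset.1 hus
    obtain ⟨a, -, has, b, hbu, hbs, hab⟩ := hu.exists_adj (s := s) hw hws hzu hzs
    have := hN.nestedHull_singleton_injective
      (hN.nestedHull_eq_of_adj ht hs has (hsub hbu) hbs hab)
    exact hru (this ▸ hbu)
  obtain ⟨w, hwt, hwu⟩ := Finset.exists_of_ssubset (Finset.ssubset_iff_subset_ne.2 ⟨hsub, hne⟩)
  have hwr : w ≠ r := fun h => hwu (h ▸ hru)
  obtain ⟨s, hws, hs⟩ := hN.exists_isNestedChild ht hwt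
    fun h => hwr (hN.nestedHull_singleton_injective h)
  have hrs : r ∉ s := fun h => hs.ssubset.2
    (nestedHull_subset hs.mem (Finset.singleton_subset_iff.2 h))
  have hconn := hN.union_isConnectedSet hs hu hru
  have hlt := hc.add_lt u s
    ⟨fun h => hwu (h ▸ Finset.mem_univ w), hu⟩
    ⟨fun h => hrs (h ▸ Finset.mem_univ r), hN.connected s hs.mem⟩
    (fun h => hrs (h hru)) (fun h => hwu (h hws)) hconn
  have hcard : u.card < (u ∪ s).card := Finset.card_lt_card
    ⟨Finset.subset_union_left, fun h => hwu (h (Finset.mem_union_right _ hws))⟩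
  have hle := Finset.card_le_univ (u ∪ s)
  have h1 := (ih _ (by omega) (u ∪ s) hconn rfl).1
  have h2 := Finset.sum_union_inter (s₁ := u) (s₂ := s) (f := x)
  have h3 : 0 ≤ ∑ v ∈ u ∩ s, x v :=
    Finset.sum_nonneg fun v _ => hN.nonneg_of_sum_eq hc hx v
  have h4 := hx s hs.mem
  linarith

end IsMaximalNestedFamily

end SimpleGraph

/-! ### The faces of a graph associahedron -/

namespace SimpleGraph

open Filter Topology

/-- The sum of the coordinates labelled by the nodes in `t`. -/
noncomputable def tubeSum {V : Type*} (t : Finset V) : StrongDual ℝ (V → ℝ) :=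
  ∑ v ∈ t, ContinuousLinearMap.proj (R := ℝ) (φ := fun _ : V => ℝ) v

theorem tubeSum_apply {V : Type*} (t : Finset V) (x : V → ℝ) : tubeSum t x = ∑ v ∈ t, x v := by
  simp [tubeSum]

variable {V : Type*} [Fintype V] [DecidableEq V] {G : SimpleGraph V} {c : Finset V → ℝ}

/-- Truncation depths growing geometrically with the size of the tube. -/
theorem exists_isTruncationDepth (G : SimpleGraph V) : ∃ c, IsTruncationDepth G c := by
  -- Two non-nested tubes are both smaller than their union, of size `n + 1`, and `2 * 3 ^ n < 3 ^
  -- (n + 1)`.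
  refine ⟨fun t => (3 : ℝ) ^ t.card / 3 ^ Fintype.card V, ⟨fun t _ => by positivity, ?_, ?_⟩⟩
  · simp
  · intro t₁ t₂ _ _ h₁ h₂ _
    have h1 : t₁.card < (t₁ ∪ t₂).card := Finset.card_lt_card
      ⟨Finset.subset_union_left, fun h => h₂ (Finset.subset_union_right.trans h)⟩
    have h2 : t₂.card < (t₁ ∪ t₂).card := Finset.card_lt_card
      ⟨Finset.subset_union_right, fun h => h₁ (Finset.subset_union_left.trans h)⟩
    obtain ⟨n, hn⟩ : ∃ n, (t₁ ∪ t₂).card = n + 1 := ⟨_, (Nat.sub_add_cancel (by omega)).symm⟩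
    have h3 : (3 : ℝ) ^ t₁.card ≤ 3 ^ n := pow_le_pow_right₀ (by norm_num) (by omega)
    have h4 : (3 : ℝ) ^ t₂.card ≤ 3 ^ n := pow_le_pow_right₀ (by norm_num) (by omega)
    have h5 : (0 : ℝ) < 3 ^ n := by positivity
    rw [← add_div, hn]
    gcongr
    rw [pow_succ]
    linarith

/-- Nonnegativity of the coordinates is implied by the inequalities of the singleton tubes; with
only one node, the coordinate is `1`. -/
theorem mem_graphAssociahedron_iff (hc : IsTruncationDepth G c) {x : V → ℝ} :
    x ∈ graphAssociahedron G c ↔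
      tubeSum Finset.univ x = 1 ∧ ∀ t, IsTube G t → c t ≤ tubeSum t x := by
  simp only [tubeSum_apply]
  refine ⟨fun h => ⟨h.1.2, h.2⟩, fun h => ⟨⟨fun v => ?_, h.1⟩, h.2⟩⟩
  by_cases hv : ({v} : Finset V) = Finset.univ
  · have := h.1
    rw [← hv, Finset.sum_singleton] at this
    linarith
  · have ht : IsTube G {v} := ⟨hv, isConnectedSet_singleton v⟩
    have := h.2 _ ht
    rw [Finset.sum_singleton] at this
    exact (hc.nonneg _ ht).trans this

theorem le_tubeSum_of_isConnectedSet (hc : IsTruncationDepth G c) {x : V → ℝ}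
    (hx : x ∈ graphAssociahedron G c) {t : Finset V} (ht : IsConnectedSet G t) :
    c t ≤ tubeSum t x := by
  rw [mem_graphAssociahedron_iff hc] at hx
  by_cases h : t = Finset.univ
  · rw [h, hx.1, hc.total]
  · exact hx.2 t ⟨h, ht⟩

/-- Tubes whose inequalities are equalities at a common point are compatible. -/
theorem tubeCompatible_of_tubeSum_eq (hc : IsTruncationDepth G c) {x : V → ℝ}
    (hx : x ∈ graphAssociahedron G c) {s t : Finset V} (hs : IsTube G s) (ht : IsTube G t)
    (hsx : tubeSum s x = c s) (htx : tubeSum t x = c t) : TubeCompatible G s t := by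
  by_contra hcon
  unfold TubeCompatible at hcon
  push Not at hcon
  obtain ⟨h1, h2, h3⟩ := hcon
  have h4 := hc.add_lt s t hs ht h1 h2 h3
  have h5 := le_tubeSum_of_isConnectedSet hc hx h3
  rw [tubeSum_apply] at hsx htx h5
  have h6 := Finset.sum_union_inter (s₁ := s) (s₂ := t) (f := x)
  have h7 : 0 ≤ ∑ v ∈ s ∩ t, x v := Finset.sum_nonneg fun v _ => hx.1.1 v
  linarith

/-- Tight inequalities are unaffected by the direction `d`, and the finitely many slack ones survive
a small step. -/
theorem exists_pos_add_smul_mem (hc : IsTruncationDepth G c) {x d : V → ℝ}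
    (hx : x ∈ graphAssociahedron G c) (hd : tubeSum Finset.univ d = 0)
    (h : ∀ t, IsTube G t → tubeSum t x = c t → tubeSum t d = 0) :
    ∃ ε : ℝ, 0 < ε ∧ x + ε • d ∈ graphAssociahedron G c := by
  have hx' := (mem_graphAssociahedron_iff hc).1 hx
  have key : ∀ᶠ ε in 𝓝[>] (0 : ℝ), ∀ t : Finset V, IsTube G t →
      c t ≤ tubeSum t x + ε * tubeSum t d := by
    rw [eventually_all]
    intro t
    by_cases ht : IsTube G t
    swap
    · exact Eventually.of_forall fun _ h => absurd h ht
    rcases (hx'.2 t ht).eq_or_lt with he | hlt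
    · exact Eventually.of_forall fun ε _ => by rw [h t ht he.symm, mul_zero, add_zero, he]
    · have hcont : Tendsto (fun ε : ℝ => tubeSum t x + ε * tubeSum t d) (𝓝[>] 0)
          (𝓝 (tubeSum t x + 0 * tubeSum t d)) :=
        ((by fun_prop : Continuous fun ε : ℝ => tubeSum t x + ε * tubeSum t d).tendsto
          0).mono_left nhdsWithin_le_nhds
      rw [zero_mul, add_zero] at hcont
      filter_upwards [hcont.eventually_const_lt hlt] with ε hε _ using hε.le
  obtain ⟨ε, hε, hpos⟩ := (key.and self_mem_nhdsWithin).exists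
  refine ⟨ε, hpos, (mem_graphAssociahedron_iff hc).2 ⟨?_, fun t ht => ?_⟩⟩
  · rw [map_add, map_smul, hx'.1, hd, smul_zero, add_zero]
  · rw [map_add, map_smul, smul_eq_mul]
    exact hε t ht

/-- The depths at the members of a set of tubes can be increased slightly. -/
theorem exists_isTruncationDepth_perturb (hc : IsTruncationDepth G c) (p : Finset V → Prop)
    (hp : ¬ p Finset.univ) :
    ∃ c', IsTruncationDepth G c' ∧ (∀ t, ¬ p t → c' t = c t) ∧ ∀ t, p t → c t < c' t := by
  classical
  -- The factor `2` allows for both depths on the left being raised while the one on the right is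
  -- not.
  have key : ∀ᶠ ε in 𝓝[>] (0 : ℝ), ∀ t₁ t₂ : Finset V, c t₁ + c t₂ < c (t₁ ∪ t₂) →
      c t₁ + c t₂ + 2 * ε < c (t₁ ∪ t₂) := by
    rw [eventually_all]
    intro t₁
    rw [eventually_all]
    intro t₂
    by_cases h : c t₁ + c t₂ < c (t₁ ∪ t₂)
    swap
    · exact Eventually.of_forall fun _ h' => absurd h' h
    have hcont : Tendsto (fun ε : ℝ => c t₁ + c t₂ + 2 * ε) (𝓝[>] 0)
        (𝓝 (c t₁ + c t₂ + 2 * 0)) :=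
      ((by fun_prop : Continuous fun ε : ℝ => c t₁ + c t₂ + 2 * ε).tendsto
        0).mono_left nhdsWithin_le_nhds
    rw [mul_zero, add_zero] at hcont
    filter_upwards [hcont.eventually_lt_const h] with ε hε _ using hε
  obtain ⟨ε, hε, hpos⟩ := (key.and self_mem_nhdsWithin).exists
  have hpos : 0 < ε := hpos
  have hle : ∀ t, c t ≤ c t + (if p t then ε else 0) ∧ c t + (if p t then ε else 0) ≤ c t + ε := by
    intro t
    split_ifs <;> constructor <;> linarith
  refine ⟨fun t => c t + if p t then ε else 0, ⟨fun t ht => ?_, ?_, ?_⟩, ?_, ?_⟩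
  · exact (hc.nonneg t ht).trans (hle t).1
  · simp [hp, hc.total]
  · intro t₁ t₂ h₁ h₂ h₃ h₄ h₅
    have h6 := hε t₁ t₂ (hc.add_lt t₁ t₂ h₁ h₂ h₃ h₄ h₅)
    have h7 := (hle t₁).2
    have h8 := (hle t₂).2
    have h9 := (hle (t₁ ∪ t₂)).1
    linarith
  · intro t ht
    simp [ht]
  · intro t ht
    simpa [ht] using hpos

/-- A labelling of the tubes of `G` by the nodes of `D`, under which adjacency in `D` is
compatibility of tubes. -/
structure IsTubeLabelling {α : Type*} (D : SimpleGraph α) (G : SimpleGraph V)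
    (φ : α → Finset V) : Prop where
  injective : Function.Injective φ
  isTube_iff : ∀ t, IsTube G t ↔ ∃ a, φ a = t
  adj_iff : ∀ a b, a ≠ b → (D.Adj a b ↔ TubeCompatible G (φ a) (φ b))

/-- The points of the graph associahedron at which the inequalities of the tubes labelled by the
elements of `S` are equalities. -/
def tubeFace {α : Type*} (G : SimpleGraph V) (c : Finset V → ℝ) (φ : α → Finset V)
    (S : Finset α) : Set (V → ℝ) :=
  {x | x ∈ graphAssociahedron G c ∧ ∀ a ∈ S, tubeSum (φ a) x = c (φ a)}

/-! ### Faces as families of tight tubes -/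

namespace IsTubeLabelling

variable {α : Type*} {D : SimpleGraph α} {φ : α → Finset V}

theorem isTube (hφ : IsTubeLabelling D G φ) (a : α) : IsTube G (φ a) :=
  (hφ.isTube_iff _).2 ⟨a, rfl⟩

theorem isNestedFamily (hφ : IsTubeLabelling D G φ) (hG : G.Connected) {S : Finset α}
    (hS : D.IsClique (S : Set α)) :
    IsNestedFamily G (insert Finset.univ (S.image φ)) where
  univ_mem := Finset.mem_insert_self _ _
  connected := by
    intro t ht
    rcases Finset.mem_insert.1 ht with rfl | ht
    · exact isConnectedSet_univ hG
    · obtain ⟨a, -, rfl⟩ := Finset.mem_image.1 ht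
      exact (hφ.isTube a).2
  compatible := by
    intro s hs t ht
    rcases Finset.mem_insert.1 hs with rfl | hs
    · exact Or.inr (Or.inl (Finset.subset_univ _))
    rcases Finset.mem_insert.1 ht with rfl | ht
    · exact Or.inl (Finset.subset_univ _)
    obtain ⟨a, ha, rfl⟩ := Finset.mem_image.1 hs
    obtain ⟨b, hb, rfl⟩ := Finset.mem_image.1 ht
    by_cases hab : a = b
    · exact Or.inl (hab ▸ subset_rfl)
    · exact (hφ.adj_iff a b hab).1 (hS ha hb hab)

/-- Every set of pairwise compatible tubes is the set of tubes whose inequalities are equalities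
at some point. -/
theorem exists_tubeSum_eq_iff (hφ : IsTubeLabelling D G φ) (hG : G.Connected)
    (hc : IsTruncationDepth G c) {S : Finset α} (hS : D.IsClique (S : Set α)) :
    ∃ x ∈ graphAssociahedron G c, ∀ a, tubeSum (φ a) x = c (φ a) ↔ a ∈ S := by
  obtain ⟨M, hSM, hM⟩ := (hφ.isNestedFamily hG hS).exists_maximal
  -- The vertex determined by `M` for the raised depths satisfies the original inequalities,
  -- strictly so at the members of `M` outside the given family.
  obtain ⟨c', hc', heq, hlt⟩ := exists_isTruncationDepth_perturb hc
    (fun t => t ∈ M ∧ t ∉ insert Finset.univ (S.image φ))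
    (fun h => h.2 (Finset.mem_insert_self _ _))
  have hle : ∀ t, c t ≤ c' t := fun t => by
    by_cases h : t ∈ M ∧ t ∉ insert Finset.univ (S.image φ)
    exacts [(hlt t h).le, (heq t h).ge]
  obtain ⟨x, hx⟩ := hM.exists_sum_eq c'
  refine ⟨x, (mem_graphAssociahedron_iff hc).2 ⟨?_, fun t ht => ?_⟩, fun a => ⟨fun h => ?_, ?_⟩⟩
  · rw [tubeSum_apply, hx _ hM.univ_mem, hc'.total]
  · rw [tubeSum_apply]
    exact (hle t).trans (hM.le_sum_and_lt_sum hc' hx t ht.2).1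
  · rw [tubeSum_apply] at h
    have haM : φ a ∈ M := by
      by_contra haM
      have := (hM.le_sum_and_lt_sum hc' hx _ (hφ.isTube a).2).2 haM
      have := hle (φ a)
      linarith
    by_contra haS
    refine (hlt (φ a) ⟨haM, fun hmem => ?_⟩).ne (by rw [← h, hx _ haM])
    rcases Finset.mem_insert.1 hmem with h' | h'
    · exact (hφ.isTube a).1 h'
    · obtain ⟨b, hb, hab⟩ := Finset.mem_image.1 h'
      exact haS (hφ.injective hab ▸ hb)
  · intro ha
    have hmem : φ a ∈ insert Finset.univ (S.image φ) :=
      Finset.mem_insert_of_mem (Finset.mem_image_of_mem φ ha)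
    rw [tubeSum_apply, hx _ (hSM hmem), heq _ fun h => h.2 hmem]

theorem tubeFace_nonempty (hφ : IsTubeLabelling D G φ) (hG : G.Connected)
    (hc : IsTruncationDepth G c) {S : Finset α} (hS : D.IsClique (S : Set α)) :
    (tubeFace G c φ S).Nonempty := by
  obtain ⟨x, hx, h⟩ := hφ.exists_tubeSum_eq_iff hG hc hS
  exact ⟨x, hx, fun a ha => (h a).2 ha⟩

theorem tubeFace_subset_iff (hφ : IsTubeLabelling D G φ) (hG : G.Connected)
    (hc : IsTruncationDepth G c) {S T : Finset α} (hS : D.IsClique (S : Set α)) :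
    tubeFace G c φ S ⊆ tubeFace G c φ T ↔ T ⊆ S := by
  refine ⟨fun h => ?_, fun h x hx => ⟨hx.1, fun a ha => hx.2 a (h ha)⟩⟩
  obtain ⟨x, hx, hxS⟩ := hφ.exists_tubeSum_eq_iff hG hc hS
  exact fun a ha => (hxS a).1 ((h ⟨hx, fun a ha => (hxS a).2 ha⟩).2 a ha)

/-- The sum of the functionals of the tubes in `S` is minimized on the face: each term is bounded
below by its depth, so the total of the depths is reached only if every term reaches its own. -/
theorem isExposed_tubeFace (hφ : IsTubeLabelling D G φ) (hc : IsTruncationDepth G c)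
    (S : Finset α) : IsExposed ℝ (graphAssociahedron G c) (tubeFace G c φ S) := by
  rintro ⟨z, hz, hzS⟩
  have hle : ∀ x ∈ graphAssociahedron G c, ∀ a ∈ S, c (φ a) ≤ tubeSum (φ a) x :=
    fun x hx a _ => le_tubeSum_of_isConnectedSet hc hx (hφ.isTube a).2
  refine ⟨-∑ a ∈ S, tubeSum (φ a), Set.ext fun x => ⟨fun hx => ⟨hx.1, fun y hy => ?_⟩,
    fun hx => ⟨hx.1, ?_⟩⟩⟩
  · simp only [neg_apply, sum_apply, neg_le_neg_iff]
    exact Finset.sum_le_sum fun a ha => (hx.2 a ha).le.trans (hle y hy a ha)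
  · have h := hx.2 z hz
    simp only [neg_apply, sum_apply, neg_le_neg_iff] at h
    rw [Finset.sum_congr rfl hzS] at h
    have h' := (Finset.sum_eq_sum_iff_of_le (hle x hx.1)).1
      (le_antisymm (Finset.sum_le_sum (hle x hx.1)) h)
    exact fun a ha => (h' a ha).symm

/-- Every non-empty exposed face is given by a set of pairwise compatible tubes. -/
theorem exists_eq_tubeFace (hφ : IsTubeLabelling D G φ) (hc : IsTruncationDepth G c)
    {F : Set (V → ℝ)} (hF : F.Nonempty) (hexp : IsExposed ℝ (graphAssociahedron G c) F) :
    ∃ S : Finset α, D.IsClique (S : Set α) ∧ tubeFace G c φ S = F := by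
  classical
  have : Finite α := Finite.of_injective φ hφ.injective
  have := Fintype.ofFinite α
  obtain ⟨f, hf⟩ := hexp hF
  let A : (V → ℝ) → Finset α := fun x => Finset.univ.filter fun a => tubeSum (φ a) x = c (φ a)
  have hA : ∀ x a, a ∈ A x ↔ tubeSum (φ a) x = c (φ a) := fun x a => by simp [A]
  -- A point with the fewest tight tubes plays the part of a relative interior point of `F`.
  obtain ⟨x, hxF, hmin⟩ : ∃ x ∈ F, ∀ y ∈ F, (A x).card ≤ (A y).card := by
    obtain ⟨x, hx, h⟩ := (measure fun x => (A x).card).wf.has_min F hF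
    exact ⟨x, hx, fun y hy => not_lt.1 (h y hy)⟩
  have hxF' := hxF
  rw [hf] at hxF'
  obtain ⟨hxP, hxmax⟩ := hxF'
  refine ⟨A x, fun a ha b hb hab => ?_, Set.Subset.antisymm ?_ ?_⟩
  · exact (hφ.adj_iff a b hab).2 (tubeCompatible_of_tubeSum_eq hc hxP (hφ.isTube a)
      (hφ.isTube b) ((hA x a).1 ha) ((hA x b).1 hb))
  · rintro y ⟨hyP, hy⟩
    have h1 := (mem_graphAssociahedron_iff hc).1 hxP
    have h2 := (mem_graphAssociahedron_iff hc).1 hyP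
    -- From `x` one can move a little away from `y`; as `f` is maximal at `x`, it follows that `f x
    -- ≤ f y`.
    obtain ⟨ε, hε, hmem⟩ := exists_pos_add_smul_mem hc (d := x - y) hxP
      (by rw [map_sub, h1.1, h2.1, sub_self]) (by
        intro t ht htx
        obtain ⟨a, rfl⟩ := (hφ.isTube_iff t).1 ht
        rw [map_sub, htx, hy a ((hA x a).2 htx), sub_self])
    have h3 := hxmax _ hmem
    rw [map_add, map_smul, map_sub, smul_eq_mul] at h3
    have h4 : f x ≤ f y := by nlinarith
    rw [hf]
    exact ⟨hyP, fun z hz => (hxmax z hz).trans h4⟩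
  · intro y hyF
    have hyF' := hyF
    rw [hf] at hyF'
    obtain ⟨hyP, hymax⟩ := hyF'
    have h1 := (mem_graphAssociahedron_iff hc).1 hxP
    have h2 := (mem_graphAssociahedron_iff hc).1 hyP
    have hm : ∀ g : StrongDual ℝ (V → ℝ), g ((2⁻¹ : ℝ) • (x + y)) = (g x + g y) / 2 :=
      fun g => by
        rw [map_smul, map_add, smul_eq_mul]
        ring
    have hzF : (2⁻¹ : ℝ) • (x + y) ∈ F := by
      rw [hf]
      refine ⟨(mem_graphAssociahedron_iff hc).2 ⟨?_, fun t ht => ?_⟩, fun w hw => ?_⟩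
      · rw [hm, h1.1, h2.1]
        norm_num
      · rw [hm]
        have := h1.2 t ht
        have := h2.2 t ht
        linarith
      · rw [hm]
        have := hxmax w hw
        have := hymax w hw
        linarith
    have hle : ∀ a, c (φ a) ≤ tubeSum (φ a) x ∧ c (φ a) ≤ tubeSum (φ a) y :=
      fun a => ⟨h1.2 _ (hφ.isTube a), h2.2 _ (hφ.isTube a)⟩
    -- A tube tight at the midpoint is tight at both ends. By minimality the midpoint has the same
    -- tight tubes as `x`, so all of these are tight at `y`.
    have hsub : A ((2⁻¹ : ℝ) • (x + y)) ⊆ A x := fun a ha => by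
      rw [hA, hm] at ha
      rw [hA]
      linarith [(hle a).1, (hle a).2]
    have heq := Finset.eq_of_subset_of_card_le hsub (hmin _ hzF)
    refine ⟨hyP, fun a ha => ?_⟩
    rw [← heq, hA, hm] at ha
    linarith [(hle a).1, (hle a).2]

/-- The sums over all nodes and over the nodes of the tubes labelled by `S`. -/
noncomputable def tubeSumMap (φ : α → Finset V) (S : Finset α) :
    (V → ℝ) →ₗ[ℝ] (Option S → ℝ) :=
  LinearMap.pi fun o => (tubeSum (o.elim Finset.univ fun a => φ a.1)).toLinearMap

theorem tubeSumMap_surjective (hφ : IsTubeLabelling D G φ) (hG : G.Connected) {S : Finset α}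
    (hS : D.IsClique (S : Set α)) : Function.Surjective (tubeSumMap φ S) := by
  intro y
  let g : Option S → Finset V := fun o => o.elim Finset.univ fun a => φ a.1
  have hg : Function.Injective g := by
    rintro (_ | a) (_ | b) h
    · rfl
    · exact absurd h.symm (hφ.isTube b.1).1
    · exact absurd h (hφ.isTube a.1).1
    · exact congrArg some (Subtype.ext (hφ.injective h))
  obtain ⟨M, hSM, hM⟩ := (hφ.isNestedFamily hG hS).exists_maximal
  -- The prescribed values off the range of `g` are immaterial; `0` is a filler.
  obtain ⟨x, hx⟩ := hM.exists_sum_eq (Function.extend g y 0)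
  refine ⟨x, funext fun o => ?_⟩
  have hmem : g o ∈ insert Finset.univ (S.image φ) := by
    rcases o with _ | a
    · exact Finset.mem_insert_self _ _
    · exact Finset.mem_insert_of_mem (Finset.mem_image_of_mem φ a.2)
  have := hx (g o) (hSM hmem)
  rw [hg.extend_apply, ← tubeSum_apply] at this
  exact this

/-- At a point where only the tubes of `S` are tight, every direction in the kernel of `tubeSumMap`
can be followed within the face. The kernel has codimension `S.card + 1` because the map is
surjective. -/
theorem finrank_vectorSpan_tubeFace (hφ : IsTubeLabelling D G φ) (hG : G.Connected)
    (hc : IsTruncationDepth G c) {S : Finset α} (hS : D.IsClique (S : Set α)) :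
    Module.finrank ℝ (vectorSpan ℝ (tubeFace G c φ S)) + S.card + 1 = Fintype.card V := by
  have hspan : vectorSpan ℝ (tubeFace G c φ S) = LinearMap.ker (tubeSumMap φ S) := by
    have hker : ∀ d, d ∈ LinearMap.ker (tubeSumMap φ S) ↔
        tubeSum Finset.univ d = 0 ∧ ∀ a ∈ S, tubeSum (φ a) d = 0 := by
      intro d
      rw [LinearMap.mem_ker, funext_iff, Option.forall]
      simp [tubeSumMap]
    apply le_antisymm
    · refine Submodule.span_le.2 ?_
      rintro _ ⟨x, hx, y, hy, rfl⟩
      change x - y ∈ LinearMap.ker (tubeSumMap φ S)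
      rw [hker]
      refine ⟨?_, fun a ha => ?_⟩
      · rw [map_sub, ((mem_graphAssociahedron_iff hc).1 hx.1).1,
          ((mem_graphAssociahedron_iff hc).1 hy.1).1, sub_self]
      · rw [map_sub, hx.2 a ha, hy.2 a ha, sub_self]
    · intro d hd
      rw [hker] at hd
      obtain ⟨x, hx, hxS⟩ := hφ.exists_tubeSum_eq_iff hG hc hS
      obtain ⟨ε, hε, hmem⟩ := exists_pos_add_smul_mem hc (d := d) hx hd.1 (by
        intro t ht htx
        obtain ⟨a, rfl⟩ := (hφ.isTube_iff t).1 ht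
        exact hd.2 a ((hxS a).1 htx))
      have h1 : x ∈ tubeFace G c φ S := ⟨hx, fun a ha => (hxS a).2 ha⟩
      have h2 : x + ε • d ∈ tubeFace G c φ S := ⟨hmem, fun a ha => by
        rw [map_add, map_smul, hd.2 a ha, smul_zero, add_zero, (hxS a).2 ha]⟩
      have h3 := vsub_mem_vectorSpan ℝ h2 h1
      rw [vsub_eq_sub, add_sub_cancel_left] at h3
      have h4 := Submodule.smul_mem _ ε⁻¹ h3
      rwa [smul_smul, inv_mul_cancel₀ hε.ne', one_smul] at h4
  have h := LinearMap.finrank_range_add_finrank_ker (tubeSumMap φ S)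
  rw [LinearMap.range_eq_top.2 (hφ.tubeSumMap_surjective hG hS), finrank_top, ← hspan,
    Module.finrank_fintype_fun_eq_card, Module.finrank_fintype_fun_eq_card, Fintype.card_option,
    Fintype.card_coe] at h
  omega

/-- If the disjointness of hypersurfaces is the compatibility of the tubes of `G`, the abstract
polytope of the hypersurfaces is the graph associahedron of `G`. -/
theorem isGraphAssociahedronOf (hφ : IsTubeLabelling D G φ) (hG : G.Connected) :
    IsGraphAssociahedronOf D G := by
  refine ⟨exists_isTruncationDepth G, fun c hc => ?_⟩
  let e : DisjointnessPolytope D ↪o PolytopeFace (graphAssociahedron G c) :=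
    { toFun := fun F => ⟨tubeFace G c φ (OrderDual.ofDual F).1,
        hφ.tubeFace_nonempty hG hc (OrderDual.ofDual F).2, hφ.isExposed_tubeFace hc _⟩
      inj' := fun F F' h => by
        have h' : tubeFace G c φ (OrderDual.ofDual F).1 = tubeFace G c φ (OrderDual.ofDual F').1 :=
          congrArg Subtype.val h
        refine OrderDual.ofDual.injective (Subtype.ext (Finset.Subset.antisymm ?_ ?_))
        · exact (hφ.tubeFace_subset_iff hG hc (OrderDual.ofDual F').2).1 h'.symm.subset
        · exact (hφ.tubeFace_subset_iff hG hc (OrderDual.ofDual F).2).1 h'.subset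
      map_rel_iff' := fun {F F'} => hφ.tubeFace_subset_iff hG hc (OrderDual.ofDual F).2 }
  have he : Function.Surjective e := by
    rintro ⟨F, hF, hexp⟩
    obtain ⟨S, hS, rfl⟩ := hφ.exists_eq_tubeFace hc hF hexp
    exact ⟨OrderDual.toDual ⟨S, hS⟩, rfl⟩
  exact ⟨RelIso.ofSurjective e he,
    fun F => hφ.finrank_vectorSpan_tubeFace hG hc (OrderDual.ofDual F).2⟩

end IsTubeLabelling

end SimpleGraph

/-! ### Cliques with paths attached -/

namespace SimpleGraph

/-- `G` consists of a clique, whose nodes are the nodes of height `0`, with a path of `n i` nodes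
starting at the `i`-th node of the clique. -/
structure IsCliqueOfStacks {V ι : Type*} (G : SimpleGraph V) (st : V → ι) (ht : V → ℕ)
    (n : ι → ℕ) : Prop where
  ext : ∀ u v, st u = st v → ht u = ht v → u = v
  height_lt : ∀ v, ht v < n (st v)
  exists_node : ∀ i a, a < n i → ∃ v, st v = i ∧ ht v = a
  pos : ∀ i, 0 < n i
  adj_iff : ∀ u v, G.Adj u v ↔ (st u ≠ st v ∧ ht u = 0 ∧ ht v = 0) ∨
    (st u = st v ∧ (ht u + 1 = ht v ∨ ht v + 1 = ht u))

/-- The nodes that lie below the height `h i` in the `i`-th stack. -/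
def stackBox {V ι : Type*} [Fintype V] (st : V → ι) (ht : V → ℕ) (h : ι → ℕ) : Finset V :=
  Finset.univ.filter fun v => ht v < h (st v)

theorem mem_stackBox {V ι : Type*} [Fintype V] {st : V → ι} {ht : V → ℕ} {h : ι → ℕ} {v : V} :
    v ∈ stackBox st ht h ↔ ht v < h (st v) := by
  simp [stackBox]

section Stack

variable {V ι : Type*} [Fintype V] [DecidableEq ι]

/-- The nodes of the `i`-th stack whose heights are at least `j` and less than `k`. -/
def stackSegment (st : V → ι) (ht : V → ℕ) (i : ι) (j k : ℕ) : Finset V :=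
  Finset.univ.filter fun v => st v = i ∧ j ≤ ht v ∧ ht v < k

/-- The set of nodes with a given code: initial segments of all stacks, or a segment of one. -/
def stackTube (st : V → ι) (ht : V → ℕ) : (ι → ℕ) ⊕ (ι × ℕ × ℕ) → Finset V
  | .inl h => stackBox st ht h
  | .inr (i, j, k) => stackSegment st ht i j k

/-- The codes of tubes. -/
def IsStackCode {ι : Type*} (n : ι → ℕ) : (ι → ℕ) ⊕ (ι × ℕ × ℕ) → Prop
  | .inl h => h ≤ n ∧ h ≠ 0 ∧ h ≠ n
  | .inr (i, j, k) => 1 ≤ j ∧ j < k ∧ k ≤ n i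

/-- Compatibility of tubes in terms of their codes. -/
def StackCodeCompatible {ι : Type*} : (ι → ℕ) ⊕ (ι × ℕ × ℕ) → (ι → ℕ) ⊕ (ι × ℕ × ℕ) → Prop
  | .inl h, .inl h' => h ≤ h' ∨ h' ≤ h
  | .inl h, .inr (i, j, k) => ¬ (j ≤ h i ∧ h i < k)
  | .inr (i, j, k), .inl h => ¬ (j ≤ h i ∧ h i < k)
  | .inr (i, j, k), .inr (i', j', k') => i = i' →
      Disjoint (Finset.Icc j k) (Finset.Icc j' k') ∨
        Finset.Icc j k ⊆ Finset.Icc j' k' ∨ Finset.Icc j' k' ⊆ Finset.Icc j k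

variable {st : V → ι} {ht : V → ℕ}

theorem mem_stackSegment {i : ι} {j k : ℕ} {v : V} :
    v ∈ stackSegment st ht i j k ↔ st v = i ∧ j ≤ ht v ∧ ht v < k := by
  simp [stackSegment]

end Stack

/-! ### Tubes of a clique with paths and their compatibility -/

namespace IsCliqueOfStacks

variable {V ι : Type*} {G : SimpleGraph V} {st : V → ι} {ht : V → ℕ} {n : ι → ℕ}

/-- A connected set containing a node of a stack contains all nodes below it in that stack, down
to any node at which another node of the set is not above in the same stack. -/
theorem mem_of_isConnectedSet (hG : IsCliqueOfStacks G st ht n) {t : Finset V}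
    (hconn : IsConnectedSet G t) {v w x : V} (hv : v ∈ t) (hw : w ∈ t) (hx : st x = st w)
    (hxw : ht x < ht w) (hvx : st v = st w → ht v ≤ ht x) : x ∈ t := by
  -- The only edges leaving the part of the stack strictly above `x` end at `x`.
  obtain ⟨u, -, ⟨hu1, hu2⟩, u', hu't, hu', hadj⟩ := hconn.exists_adj
    (s := {u | st u = st w ∧ ht x < ht u}) hw ⟨rfl, hxw⟩ hv
    (fun h => (hvx h.1).not_gt h.2)
  rcases (hG.adj_iff u u').1 hadj with h | h
  · omega
  · have h1 : st u' = st w := h.1.symm.trans hu1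
    have h2 : ¬ ht x < ht u' := fun h' => hu' ⟨h1, h'⟩
    exact hG.ext u' x (h1.trans hx.symm) (by omega) ▸ hu't

variable [Fintype V]

theorem stackBox_subset_iff (hG : IsCliqueOfStacks G st ht n) {h h' : ι → ℕ} (hn : h ≤ n) :
    stackBox st ht h ⊆ stackBox st ht h' ↔ h ≤ h' := by
  refine ⟨fun hsub i => ?_, fun hle v hv => ?_⟩
  · by_contra! hlt
    obtain ⟨v, rfl, hv⟩ := hG.exists_node i (h' i) (hlt.trans_le (hn i))
    have := mem_stackBox.1 (hsub (mem_stackBox.2 (hv ▸ hlt)))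
    omega
  · exact mem_stackBox.2 ((mem_stackBox.1 hv).trans_le (hle _))

theorem isConnectedSet_stackBox (hG : IsCliqueOfStacks G st ht n) {h : ι → ℕ} (hn : h ≤ n) {i : ι}
    (hi : 0 < h i) : IsConnectedSet G (stackBox st ht h) := by
  obtain ⟨a, rfl, ha⟩ := hG.exists_node i 0 (hG.pos i)
  refine isConnectedSet_of_exists_adj (a := a) (mem_stackBox.2 (ha ▸ hi)) ?_
  intro s has hs b hb hbs
  -- A lowest node outside `s` is joined to `s`: to `a` if it lies in the clique, otherwise to the
  -- node just below it.
  obtain ⟨b, ⟨hb, hbs⟩, hmin⟩ := (measure ht).wf.has_min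
    {b | b ∈ stackBox st ht h ∧ b ∉ s} ⟨b, hb, hbs⟩
  rw [mem_stackBox] at hb
  rcases hb0 : ht b with _ | m
  · refine ⟨a, has, b, mem_stackBox.2 hb, hbs, (hG.adj_iff a b).2 (Or.inl ⟨fun hab => ?_, ha, hb0⟩)⟩
    exact hbs (hG.ext a b hab (ha.trans hb0.symm) ▸ has)
  · obtain ⟨u, hu, hum⟩ := hG.exists_node (st b) m (by
      have : h (st b) ≤ n (st b) := hn _
      omega)
    refine ⟨u, ?_, b, mem_stackBox.2 hb, hbs, (hG.adj_iff u b).2 (Or.inr ⟨hu, Or.inl (by omega)⟩)⟩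
    by_contra hus
    refine hmin u ⟨mem_stackBox.2 (by rw [hu]; omega), hus⟩ ?_
    change ht u < ht b
    omega

theorem stackBox_eq_univ (hG : IsCliqueOfStacks G st ht n) :
    stackBox st ht n = Finset.univ :=
  Finset.eq_univ_of_forall fun v => mem_stackBox.2 (hG.height_lt v)

theorem connected [Nonempty ι] (hG : IsCliqueOfStacks G st ht n) : G.Connected := by
  obtain ⟨i⟩ := ‹Nonempty ι›
  have h := hG.isConnectedSet_stackBox le_rfl (hG.pos i)
  rw [hG.stackBox_eq_univ] at h
  unfold IsConnectedSet at h
  rw [Finset.coe_univ] at h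
  exact (induceUnivIso G).connected_iff.1 h

/-- The union of two boxes is the box of the supremum, which meets the clique and is connected; only
nesting remains. -/
theorem tubeCompatible_stackBox_iff [DecidableEq V] (hG : IsCliqueOfStacks G st ht n)
    {h h' : ι → ℕ} (hn : h ≤ n) (h0 : h ≠ 0) (hn' : h' ≤ n) :
    TubeCompatible G (stackBox st ht h) (stackBox st ht h') ↔ h ≤ h' ∨ h' ≤ h := by
  have hunion : stackBox st ht h ∪ stackBox st ht h' = stackBox st ht (h ⊔ h') := by
    ext v
    simp [mem_stackBox]
  obtain ⟨i, hi⟩ := Function.ne_iff.1 h0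
  have hconn : IsConnectedSet G (stackBox st ht (h ⊔ h')) :=
    hG.isConnectedSet_stackBox (sup_le hn hn') (i := i)
      (lt_max_of_lt_left (Nat.pos_of_ne_zero hi))
  unfold TubeCompatible
  rw [hunion, hG.stackBox_subset_iff hn, hG.stackBox_subset_iff hn']
  tauto

variable [DecidableEq ι]

theorem isConnectedSet_stackSegment (hG : IsCliqueOfStacks G st ht n) {i : ι} {j k : ℕ}
    (hjk : j < k) (hk : k ≤ n i) : IsConnectedSet G (stackSegment st ht i j k) := by
  obtain ⟨a, rfl, ha⟩ := hG.exists_node i j (by omega)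
  refine isConnectedSet_of_exists_adj (a := a) (mem_stackSegment.2 ⟨rfl, by omega, by omega⟩) ?_
  intro s has hs b hb hbs
  obtain ⟨b, ⟨hb, hbs⟩, hmin⟩ := (measure ht).wf.has_min
    {b | b ∈ stackSegment st ht (st a) j k ∧ b ∉ s} ⟨b, hb, hbs⟩
  have hb' := mem_stackSegment.1 hb
  have hne : ht b ≠ j := fun h => hbs (hG.ext a b hb'.1.symm (ha.trans h.symm) ▸ has)
  obtain ⟨u, hu, hum⟩ := hG.exists_node (st a) (ht b - 1) (by omega)
  refine ⟨u, ?_, b, hb, hbs,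
    (hG.adj_iff u b).2 (Or.inr ⟨hu.trans hb'.1.symm, Or.inl (by omega)⟩)⟩
  by_contra hus
  refine hmin u ⟨mem_stackSegment.2 ⟨hu, by omega, by omega⟩, hus⟩ ?_
  change ht u < ht b
  omega

/-- Paths communicate only through the clique. A connected set meeting the clique is closed
downwards in each stack; one missing it stays in one stack and has no gaps. -/
theorem exists_stackTube_eq (hG : IsCliqueOfStacks G st ht n) {t : Finset V}
    (hconn : IsConnectedSet G t) (hne : t ≠ Finset.univ) :
    ∃ p, IsStackCode n p ∧ stackTube st ht p = t := by
  by_cases hz : ∃ z ∈ t, ht z = 0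
  · obtain ⟨z, hzt, hz⟩ := hz
    -- One more than the greatest height reached in the stack, and `0` for a stack that is missed.
    let h : ι → ℕ := fun i => (t.filter fun v => st v = i).sup fun v => ht v + 1
    have hlt : ∀ v ∈ t, ht v < h (st v) := fun v hv =>
      Finset.le_sup (f := fun v => ht v + 1) (Finset.mem_filter.2 ⟨hv, rfl⟩)
    have heq : stackBox st ht h = t := by
      ext v
      rw [mem_stackBox]
      refine ⟨fun hv => ?_, hlt v⟩
      obtain ⟨w, hw, hvw⟩ := Finset.lt_sup_iff.1 hv
      obtain ⟨hwt, hw⟩ := Finset.mem_filter.1 hw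
      rcases (Nat.lt_succ_iff.1 hvw).eq_or_lt with h' | h'
      · exact hG.ext w v hw h'.symm ▸ hwt
      · exact hG.mem_of_isConnectedSet hconn hzt hwt hw.symm h' fun _ => by omega
    refine ⟨.inl h, ⟨fun i => Finset.sup_le fun v hv => ?_, fun h0 => ?_, fun h' => ?_⟩, heq⟩
    · rw [← (Finset.mem_filter.1 hv).2]
      exact hG.height_lt v
    · have := hlt z hzt
      rw [h0] at this
      exact Nat.not_lt_zero _ this
    · exact hne (by rw [← heq, h', hG.stackBox_eq_univ])
  · push Not at hz
    have hst : ∀ v ∈ t, ∀ w ∈ t, st v = st w := by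
      intro v hv w hw
      by_contra hvw
      obtain ⟨x, hx, hx0⟩ := hG.exists_node (st w) 0 (hG.pos _)
      exact hz x (hG.mem_of_isConnectedSet hconn hv hw hx
        (hx0 ▸ Nat.pos_of_ne_zero (hz w hw)) fun h => absurd h hvw) hx0
    obtain ⟨v, hv, hvmin⟩ := Finset.exists_min_image t ht hconn.nonempty
    obtain ⟨w, hw, hwmax⟩ := Finset.exists_max_image t ht hconn.nonempty
    refine ⟨.inr (st v, ht v, ht w + 1), ⟨Nat.pos_of_ne_zero (hz v hv),
      Nat.lt_succ_of_le (hvmin w hw), hst w hw v hv ▸ hG.height_lt w⟩, ?_⟩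
    ext u
    refine ⟨fun hu => ?_, fun hu => mem_stackSegment.2
      ⟨hst u hu v hv, hvmin u hu, Nat.lt_succ_of_le (hwmax u hu)⟩⟩
    obtain ⟨h1, h2, h3⟩ := mem_stackSegment.1 hu
    have huw := h1.trans (hst v hv w hw)
    rcases (Nat.lt_succ_iff.1 h3).eq_or_lt with h' | h'
    · exact hG.ext w u huw.symm h'.symm ▸ hw
    · exact hG.mem_of_isConnectedSet hconn hv hw huw h' fun _ => h2

theorem stackSegment_subset_iff (hG : IsCliqueOfStacks G st ht n) {i : ι} {j k j' k' : ℕ}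
    (hjk : j < k) (hk : k ≤ n i) :
    stackSegment st ht i j k ⊆ stackSegment st ht i j' k' ↔ j' ≤ j ∧ k ≤ k' := by
  refine ⟨fun hsub => ?_, fun hle v hv => ?_⟩
  · obtain ⟨v, hv, hvj⟩ := hG.exists_node i j (by omega)
    obtain ⟨w, hw, hwk⟩ := hG.exists_node i (k - 1) (by omega)
    have h1 := mem_stackSegment.1 (hsub (mem_stackSegment.2 ⟨hv, by omega, by omega⟩))
    have h2 := mem_stackSegment.1 (hsub (mem_stackSegment.2 ⟨hw, by omega, by omega⟩))
    omega
  · obtain ⟨h1, h2, h3⟩ := mem_stackSegment.1 hv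
    exact mem_stackSegment.2 ⟨h1, by omega, by omega⟩

theorem not_stackBox_subset_stackSegment (hG : IsCliqueOfStacks G st ht n) {h : ι → ℕ}
    (h0 : h ≠ 0) {i : ι} {j k : ℕ} (hj : 1 ≤ j) :
    ¬ stackBox st ht h ⊆ stackSegment st ht i j k := by
  intro hsub
  obtain ⟨i', hi'⟩ := Function.ne_iff.1 h0
  obtain ⟨v, rfl, hv⟩ := hG.exists_node i' 0 (hG.pos i')
  have := mem_stackSegment.1 (hsub (mem_stackBox.2 (hv ▸ Nat.pos_of_ne_zero hi')))
  omega

theorem stackTube_injOn (hG : IsCliqueOfStacks G st ht n) :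
    Set.InjOn (stackTube st ht) {p | IsStackCode n p} := by
  rintro (h | ⟨i, j, k⟩) hp (h' | ⟨i', j', k'⟩) hq heq
  · exact congrArg _ (le_antisymm ((hG.stackBox_subset_iff hp.1).1 heq.subset)
      ((hG.stackBox_subset_iff hq.1).1 heq.symm.subset))
  · exact absurd heq.subset (hG.not_stackBox_subset_stackSegment hp.2.1 hq.1)
  · exact absurd heq.symm.subset (hG.not_stackBox_subset_stackSegment hq.2.1 hp.1)
  · obtain ⟨hp1, hp2, hp3⟩ := hp
    obtain ⟨hq1, hq2, hq3⟩ := hq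
    change stackSegment st ht i j k = stackSegment st ht i' j' k' at heq
    obtain ⟨v, hv, hvj⟩ := hG.exists_node i j (by omega)
    have hvi := mem_stackSegment.1 (heq ▸ mem_stackSegment.2 ⟨hv, hvj.ge, by omega⟩ :
      v ∈ stackSegment st ht i' j' k')
    obtain rfl : i = i' := hv.symm.trans hvi.1
    have h1 := (hG.stackSegment_subset_iff hp2 hp3).1 heq.subset
    have h2 := (hG.stackSegment_subset_iff hq2 hq3).1 heq.symm.subset
    obtain rfl : j = j' := by omega
    obtain rfl : k = k' := by omega
    rfl

theorem isTube_stackTube (hG : IsCliqueOfStacks G st ht n)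
    {p : (ι → ℕ) ⊕ (ι × ℕ × ℕ)} (hp : IsStackCode n p) : IsTube G (stackTube st ht p) := by
  rcases p with h | ⟨i, j, k⟩
  · obtain ⟨i, hi⟩ := Function.ne_iff.1 hp.2.1
    refine ⟨fun hu => hp.2.2 ?_, hG.isConnectedSet_stackBox hp.1 (Nat.pos_of_ne_zero hi)⟩
    rw [← hG.stackBox_eq_univ] at hu
    exact le_antisymm hp.1 ((hG.stackBox_subset_iff le_rfl).1 hu.symm.subset)
  · obtain ⟨h1, h2, h3⟩ := hp
    refine ⟨fun hu => ?_, hG.isConnectedSet_stackSegment h2 h3⟩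
    obtain ⟨v, -, hv⟩ := hG.exists_node i 0 (hG.pos i)
    have := mem_stackSegment.1 ((Finset.ext_iff.1 hu v).2 (Finset.mem_univ v))
    omega

variable [DecidableEq V]

theorem tubeCompatible_stackBox_stackSegment_iff (hG : IsCliqueOfStacks G st ht n) {h : ι → ℕ}
    (hn : h ≤ n) (h0 : h ≠ 0) {i : ι} {j k : ℕ} (hj : 1 ≤ j) (hjk : j < k) (hk : k ≤ n i) :
    TubeCompatible G (stackBox st ht h) (stackSegment st ht i j k) ↔
      ¬ (j ≤ h i ∧ h i < k) := by
  obtain ⟨i', hi'⟩ := Function.ne_iff.1 h0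
  have hi' : 0 < h i' := Nat.pos_of_ne_zero hi'
  constructor
  · rintro hc ⟨h1, h2⟩
    obtain ⟨v, hv, hvh⟩ := hG.exists_node i (h i) (by omega)
    obtain ⟨w, hw, hwh⟩ := hG.exists_node i (h i - 1) (by omega)
    have hvS : v ∈ stackSegment st ht i j k := mem_stackSegment.2 ⟨hv, by omega, by omega⟩
    have hwB : w ∈ stackBox st ht h := mem_stackBox.2 (by rw [hw]; omega)
    have hconn := (hG.isConnectedSet_stackBox hn hi').union_of_adj
      (hG.isConnectedSet_stackSegment hjk hk) hwB hvS
      ((hG.adj_iff w v).2 (Or.inr ⟨hw.trans hv.symm, Or.inl (by omega)⟩))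
    rcases hc.subset_or_subset hconn with h' | h'
    · exact hG.not_stackBox_subset_stackSegment h0 hj h'
    · have := mem_stackBox.1 (h' hvS)
      rw [hv] at this
      omega
  · intro hc
    by_cases hkh : k ≤ h i
    · refine Or.inr (Or.inl fun v hv => mem_stackBox.2 ?_)
      obtain ⟨h1, h2, h3⟩ := mem_stackSegment.1 hv
      rw [h1]
      omega
    refine Or.inr (Or.inr fun hconn => ?_)
    -- Here `h i < j`, so the node of height `j - 1` is in neither set, yet it separates the segment
    -- from the clique.
    obtain ⟨w, hw, hwj⟩ := hG.exists_node i j (by omega)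
    obtain ⟨x, hx, hxj⟩ := hG.exists_node i (j - 1) (by omega)
    obtain ⟨v, hv, hv0⟩ := hG.exists_node i' 0 (hG.pos i')
    have hmem := hG.mem_of_isConnectedSet hconn (v := v) (w := w) (x := x)
      (Finset.mem_union_left _ (mem_stackBox.2 (by rw [hv]; omega)))
      (Finset.mem_union_right _ (mem_stackSegment.2 ⟨hw, by omega, by omega⟩))
      (hx.trans hw.symm) (by omega) (fun _ => by omega)
    rw [Finset.mem_union, mem_stackBox, mem_stackSegment, hx] at hmem
    omega

/-- As `k < j'`, the node of height `j' - 1` lies in the gap between the two segments. -/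
theorem tubeCompatible_stackSegment_of_lt (hG : IsCliqueOfStacks G st ht n) {i : ι}
    {j k j' k' : ℕ} (hjk : j < k) (hk' : k' ≤ n i) (hjk' : j' < k') (hlt : k < j') :
    TubeCompatible G (stackSegment st ht i j k) (stackSegment st ht i j' k') := by
  refine Or.inr (Or.inr fun hconn => ?_)
  obtain ⟨w, hw, hwj⟩ := hG.exists_node i j' (by omega)
  obtain ⟨x, hx, hxj⟩ := hG.exists_node i (j' - 1) (by omega)
  obtain ⟨v, hv, hvj⟩ := hG.exists_node i j (by omega)
  have hmem := hG.mem_of_isConnectedSet hconn (v := v) (w := w) (x := x)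
    (Finset.mem_union_left _ (mem_stackSegment.2 ⟨hv, by omega, by omega⟩))
    (Finset.mem_union_right _ (mem_stackSegment.2 ⟨hw, by omega, by omega⟩))
    (hx.trans hw.symm) (by omega) (fun _ => by omega)
  rw [Finset.mem_union, mem_stackSegment, mem_stackSegment] at hmem
  omega

theorem not_tubeCompatible_stackSegment (hG : IsCliqueOfStacks G st ht n) {i : ι}
    {j k j' k' : ℕ} (hk' : k' ≤ n i) (hj : j < j') (hjk : j' ≤ k) (hk : k < k') :
    ¬ TubeCompatible G (stackSegment st ht i j k) (stackSegment st ht i j' k') := by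
  intro hc
  have hunion : stackSegment st ht i j k ∪ stackSegment st ht i j' k' =
      stackSegment st ht i j k' := by
    ext v
    simp only [Finset.mem_union, mem_stackSegment]
    constructor
    · rintro (h | h) <;> exact ⟨h.1, by omega, by omega⟩
    · intro h
      by_cases hv : ht v < k
      · exact Or.inl ⟨h.1, by omega, hv⟩
      · exact Or.inr ⟨h.1, by omega, by omega⟩
  rcases hc.subset_or_subset (hunion ▸ hG.isConnectedSet_stackSegment (by omega) hk') with h | h
  · have := (hG.stackSegment_subset_iff (by omega) (by omega)).1 h
    omega
  · have := (hG.stackSegment_subset_iff (by omega) (by omega)).1 h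
    omega

theorem tubeCompatible_stackSegment_of_ne (hG : IsCliqueOfStacks G st ht n) {i i' : ι}
    {j k j' k' : ℕ} (hne : i ≠ i') (hj : 1 ≤ j) (hjk : j < k) (hk : k ≤ n i)
    (hj' : 1 ≤ j') (hjk' : j' < k') (hk' : k' ≤ n i') :
    TubeCompatible G (stackSegment st ht i j k) (stackSegment st ht i' j' k') := by
  refine Or.inr (Or.inr fun hconn => ?_)
  obtain ⟨w, hw, hwj⟩ := hG.exists_node i' j' (by omega)
  obtain ⟨x, hx, hxj⟩ := hG.exists_node i' 0 (by omega)
  obtain ⟨v, hv, hvj⟩ := hG.exists_node i j (by omega)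
  have hmem := hG.mem_of_isConnectedSet hconn (v := v) (w := w) (x := x)
    (Finset.mem_union_left _ (mem_stackSegment.2 ⟨hv, by omega, by omega⟩))
    (Finset.mem_union_right _ (mem_stackSegment.2 ⟨hw, by omega, by omega⟩))
    (hx.trans hw.symm) (by omega) (fun h => absurd (hv.symm.trans (h.trans hw)) hne)
  rw [Finset.mem_union, mem_stackSegment, mem_stackSegment] at hmem
  omega

/-- A segment has heights `j, …, k - 1`, so two segments of a stack meet or touch exactly when the
closed intervals `{j, …, k}` and `{j', …, k'}` overlap. -/
theorem tubeCompatible_stackSegment_iff (hG : IsCliqueOfStacks G st ht n) {i i' : ι}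
    {j k j' k' : ℕ} (hj : 1 ≤ j) (hjk : j < k) (hk : k ≤ n i)
    (hj' : 1 ≤ j') (hjk' : j' < k') (hk' : k' ≤ n i') :
    TubeCompatible G (stackSegment st ht i j k) (stackSegment st ht i' j' k') ↔
      (i = i' → Disjoint (Finset.Icc j k) (Finset.Icc j' k') ∨
        Finset.Icc j k ⊆ Finset.Icc j' k' ∨ Finset.Icc j' k' ⊆ Finset.Icc j k) := by
  by_cases hne : i = i'
  swap
  · exact iff_of_true (hG.tubeCompatible_stackSegment_of_ne hne hj hjk hk hj' hjk' hk')
      fun h => absurd h hne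
  subst hne
  have hdis : Disjoint (Finset.Icc j k) (Finset.Icc j' k') ↔ k < j' ∨ k' < j := by
    rw [Finset.disjoint_left]
    refine ⟨fun h => ?_, fun h a ha => ?_⟩
    · by_contra! hcon
      -- The larger lower end lies in both intervals unless one ends before the other begins.
      have := @h (max j j')
      simp only [Finset.mem_Icc] at this
      omega
    · simp only [Finset.mem_Icc] at ha ⊢
      omega
  rw [Finset.Icc_subset_Icc_iff hjk.le, Finset.Icc_subset_Icc_iff hjk'.le, hdis]
  constructor
  · intro hc _
    by_contra! hcon
    obtain ⟨h1, h2, h3⟩ := hcon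
    rcases lt_or_ge j j' with h | h
    · exact hG.not_tubeCompatible_stackSegment hk' h h1.1 (by omega) hc
    · exact hG.not_tubeCompatible_stackSegment hk (by omega) h1.2 (by omega) hc.symm
  · intro h
    rcases h rfl with (h | h) | h | h
    · exact hG.tubeCompatible_stackSegment_of_lt hjk hk' hjk' h
    · exact (hG.tubeCompatible_stackSegment_of_lt hjk' hk hjk h).symm
    · exact Or.inl ((hG.stackSegment_subset_iff hjk hk).2 h)
    · exact Or.inr (Or.inl ((hG.stackSegment_subset_iff hjk' hk').2 h))

theorem tubeCompatible_stackTube_iff (hG : IsCliqueOfStacks G st ht n)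
    {p q : (ι → ℕ) ⊕ (ι × ℕ × ℕ)} (hp : IsStackCode n p) (hq : IsStackCode n q) :
    TubeCompatible G (stackTube st ht p) (stackTube st ht q) ↔ StackCodeCompatible p q := by
  rcases p with h | ⟨i, j, k⟩ <;> rcases q with h' | ⟨i', j', k'⟩
  · exact hG.tubeCompatible_stackBox_iff hp.1 hp.2.1 hq.1
  · exact hG.tubeCompatible_stackBox_stackSegment_iff hp.1 hp.2.1 hq.1 hq.2.1 hq.2.2
  · exact ⟨fun h => (hG.tubeCompatible_stackBox_stackSegment_iff hq.1 hq.2.1 hp.1 hp.2.1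
      hp.2.2).1 h.symm, fun h => ((hG.tubeCompatible_stackBox_stackSegment_iff hq.1 hq.2.1 hp.1
      hp.2.1 hp.2.2).2 h).symm⟩
  · exact hG.tubeCompatible_stackSegment_iff hp.1 hp.2.1 hp.2.2 hq.1 hq.2.1 hq.2.2

/-- The abstract polytope of hypersurfaces coded like the tubes of a clique with paths attached
is the graph associahedron of that graph. -/
theorem isGraphAssociahedronOf [Nonempty ι] (hG : IsCliqueOfStacks G st ht n) {α : Type*}
    {D : SimpleGraph α} {code : α → (ι → ℕ) ⊕ (ι × ℕ × ℕ)} (hinj : Function.Injective code)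
    (hrange : ∀ p, IsStackCode n p ↔ ∃ a, code a = p)
    (hadj : ∀ a b, a ≠ b → (D.Adj a b ↔ StackCodeCompatible (code a) (code b))) :
    IsGraphAssociahedronOf D G := by
  have hcode : ∀ a, IsStackCode n (code a) := fun a => (hrange _).2 ⟨a, rfl⟩
  have hlab : IsTubeLabelling D G fun a => stackTube st ht (code a) :=
    { injective := fun a b h => hinj (hG.stackTube_injOn (hcode a) (hcode b) h)
      isTube_iff := fun t => by
        constructor
        · rintro ⟨hne, hconn⟩
          obtain ⟨p, hp, rfl⟩ := hG.exists_stackTube_eq hconn hne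
          obtain ⟨a, rfl⟩ := (hrange p).1 hp
          exact ⟨a, rfl⟩
        · rintro ⟨a, rfl⟩
          exact hG.isTube_stackTube (hcode a)
      adj_iff := fun a b hab => by
        rw [hG.tubeCompatible_stackTube_iff (hcode a) (hcode b)]
        exact hadj a b hab }
  exact hlab.isGraphAssociahedronOf hG.connected

end IsCliqueOfStacks

end SimpleGraph

/-! ### The hypersurfaces of a lattice -/

open SimpleGraph

theorem isCliqueOfStacks_cliqueWithPaths {l : ℕ} {n : Fin l → ℕ} (hn : ∀ i, 1 ≤ n i) :
    IsCliqueOfStacks (cliqueWithPaths n) (fun v => v.1) (fun v => (v.2 : ℕ)) n where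
  ext := by
    rintro ⟨i, a⟩ ⟨j, b⟩ (rfl : i = j) h
    exact congrArg _ (Fin.ext h)
  height_lt v := v.2.2
  exists_node i a ha := ⟨⟨i, a, ha⟩, rfl, rfl⟩
  pos := hn
  adj_iff _ _ := Iff.rfl

/-- The code of the tube corresponding to a hypersurface of a product of chains. -/
def ChainHypersurface.code {l : ℕ} {n : Fin l → ℕ} :
    ChainHypersurface n → (Fin l → ℕ) ⊕ (Fin l × ℕ × ℕ)
  | .Y I => .inl fun i => I.1 i
  | .S i j k _ _ _ => .inr (i, j, k)

theorem ChainHypersurface.isGraphAssociahedronOf {l : ℕ} {n : Fin l → ℕ} (hl : 1 ≤ l)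
    (hn : ∀ i, 1 ≤ n i) :
    IsGraphAssociahedronOf (ChainHypersurface.graph n) (cliqueWithPaths n) := by
  have : Nonempty (Fin l) := ⟨⟨0, hl⟩⟩
  refine (isCliqueOfStacks_cliqueWithPaths hn).isGraphAssociahedronOf
    (code := ChainHypersurface.code) ?_ ?_ ?_
  · rintro (I | ⟨i, j, k, _, _, _⟩) (J | ⟨i', j', k', _, _, _⟩) h
    · refine congrArg _ (Subtype.ext (funext fun i => Fin.ext ?_))
      exact congrFun (Sum.inl_injective h) i
    · cases h
    · cases h
    · cases h
      rfl
  · rintro (h | ⟨i, j, k⟩)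
    · constructor
      · rintro ⟨h1, h2, h3⟩
        let I : ChainLattice n := fun i => ⟨h i, Nat.lt_succ_of_le (h1 i)⟩
        have hI : ∀ i, (I i : ℕ) = h i := fun _ => rfl
        refine ⟨.Y ⟨I, fun hb => h2 (funext fun i => ?_), fun ht => h3 (funext fun i => ?_)⟩, rfl⟩
        · rw [← hI, hb]
          rfl
        · rw [← hI, ht]
          rfl
      · rintro ⟨I | _, ha⟩
        · cases ha
          refine ⟨fun i => Nat.le_of_lt_succ (I.1 i).2, fun h0 => I.2.1 (funext fun i => ?_),
            fun h1 => I.2.2 (funext fun i => ?_)⟩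
          · exact Fin.ext (congrFun h0 i)
          · exact Fin.ext (congrFun h1 i)
        · cases ha
    · constructor
      · rintro ⟨h1, h2, h3⟩
        exact ⟨.S i j k h1 h2 h3, rfl⟩
      · rintro ⟨_ | ⟨i, j, k, h1, h2, h3⟩, ha⟩
        · cases ha
        · cases ha
          exact ⟨h1, h2, h3⟩
  · rintro (I | ⟨i, j, k, h1, h2, h3⟩) (J | ⟨i', j', k', _, _, _⟩) hne
    · have hIJ : I ≠ J := fun h => hne (congrArg _ h)
      change (I < J ∨ J < I) ↔ (I ≤ J ∨ J ≤ I)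
      rw [hIJ.le_iff_lt, hIJ.symm.le_iff_lt]
    · exact Iff.rfl
    · exact Iff.rfl
    · refine and_iff_right fun h => hne ?_
      cases h
      rfl

/-- A leaf is the node of height `1` of a stack with two nodes. The only segment off the clique in
such a stack is the leaf itself, with code `(1, 2)`, which accounts for there being one `S_i` per
leaf. -/
theorem isCliqueOfStacks_cliqueWithLeaves (m k : ℕ) :
    IsCliqueOfStacks (cliqueWithLeaves m k) (Sum.elim id Sum.inl)
      (Sum.elim (fun _ => 0) fun _ => 1) (Sum.elim (fun _ => 2) fun _ => 1) where
  ext := by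
    rintro (a | i) (b | j) h h' <;> simp_all
  height_lt := by
    rintro ((i | j) | i) <;> simp
  exists_node := by
    rintro (i | j) a ha
    · obtain rfl | rfl : a = 0 ∨ a = 1 := by
        simp only [Sum.elim_inl] at ha
        omega
      · exact ⟨.inl (.inl i), rfl, rfl⟩
      · exact ⟨.inr i, rfl, rfl⟩
    · obtain rfl : a = 0 := by
        simp only [Sum.elim_inr] at ha
        omega
      exact ⟨.inl (.inr j), rfl, rfl⟩
  pos := by
    rintro (i | j) <;> simp
  adj_iff := by
    rintro (a | i) (b | j) <;> simp [cliqueWithLeaves, eq_comm]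

/-- The code of the tube corresponding to a hypersurface of `{0,1,∞}^m × {0,1}^k`. -/
def CubeHypersurface.code {m k : ℕ} :
    CubeHypersurface m k → (Fin m ⊕ Fin k → ℕ) ⊕ ((Fin m ⊕ Fin k) × ℕ × ℕ)
  | .Y I => .inl (Sum.elim (fun i => I.1.1 i) fun j => I.1.2 j)
  | .S i => .inr (.inl i, 1, 2)

theorem CubeHypersurface.isGraphAssociahedronOf {m k : ℕ} (hmk : 1 ≤ m + k) :
    IsGraphAssociahedronOf (CubeHypersurface.graph m k) (cliqueWithLeaves m k) := by
  have : Nonempty (Fin m ⊕ Fin k) := ⟨finSumFinEquiv.symm ⟨0, hmk⟩⟩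
  refine (isCliqueOfStacks_cliqueWithLeaves m k).isGraphAssociahedronOf
    (code := CubeHypersurface.code) ?_ ?_ ?_
  · rintro (I | i) (J | i') h
    · have h' := congrFun (Sum.inl_injective h)
      refine congrArg _ (Subtype.ext (Prod.ext (funext fun i => Fin.ext ?_)
        (funext fun j => Fin.ext ?_)))
      · exact h' (.inl i)
      · exact h' (.inr j)
    · cases h
    · cases h
    · cases h
      rfl
  · rintro (h | ⟨i, j, j'⟩)
    · constructor
      · rintro ⟨h1, h2, h3⟩
        let I : CubeLattice m k := (fun i => ⟨h (.inl i), Nat.lt_succ_of_le (h1 (.inl i))⟩,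
          fun j => ⟨h (.inr j), Nat.lt_succ_of_le (h1 (.inr j))⟩)
        have hI1 : ∀ i, (I.1 i : ℕ) = h (.inl i) := fun _ => rfl
        have hI2 : ∀ j, (I.2 j : ℕ) = h (.inr j) := fun _ => rfl
        refine ⟨.Y ⟨I, fun hb => h2 (funext ?_), fun ht => h3 (funext ?_)⟩, ?_⟩
        · rintro (i | j)
          · rw [← hI1, hb]
            rfl
          · rw [← hI2, hb]
            rfl
        · rintro (i | j)
          · rw [← hI1, ht]
            rfl
          · rw [← hI2, ht]
            rfl
        · refine congrArg Sum.inl (funext ?_)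
          rintro (i | j) <;> rfl
      · rintro ⟨I | _, ha⟩
        · cases ha
          refine ⟨?_, fun h0 => I.2.1 (Prod.ext (funext fun i => ?_) (funext fun j => ?_)),
            fun h1 => I.2.2 (Prod.ext (funext fun i => ?_) (funext fun j => ?_))⟩
          · rintro (i | j)
            · exact Nat.le_of_lt_succ (I.1.1 i).2
            · exact Nat.le_of_lt_succ (I.1.2 j).2
          · exact Fin.ext (congrFun h0 (.inl i))
          · exact Fin.ext (congrFun h0 (.inr j))
          · exact Fin.ext (congrFun h1 (.inl i))
          · exact Fin.ext (congrFun h1 (.inr j))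
        · cases ha
    · constructor
      · rintro ⟨h1, h2, h3⟩
        rcases i with i | i
        · simp only [Sum.elim_inl] at h3
          obtain rfl : j = 1 := by omega
          obtain rfl : j' = 2 := by omega
          exact ⟨.S i, rfl⟩
        · simp only [Sum.elim_inr] at h3
          omega
      · rintro ⟨_ | i, ha⟩
        · cases ha
        · cases ha
          exact ⟨le_rfl, Nat.one_lt_two, le_rfl⟩
  · have hYS : ∀ (I : InternalVertex (CubeLattice m k)) (i : Fin m),
        I.1.1 i ≠ 1 ↔ ¬ (1 ≤ (I.1.1 i : ℕ) ∧ (I.1.1 i : ℕ) < 2) := by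
      intro I i
      rw [Ne, Fin.ext_iff, Fin.val_one]
      omega
    rintro (I | i) (J | i') hne
    · have hIJ : I ≠ J := fun h => hne (congrArg _ h)
      have hle : ∀ I J : InternalVertex (CubeLattice m k), I ≤ J ↔
          (Sum.elim (fun i => (I.1.1 i : ℕ)) fun j => (I.1.2 j : ℕ)) ≤
            Sum.elim (fun i => (J.1.1 i : ℕ)) fun j => (J.1.2 j : ℕ) := fun I J => by
        rw [Sum.elim_le_elim_iff]
        exact Iff.rfl
      change (I < J ∨ J < I) ↔ (_ ≤ _ ∨ _ ≤ _)
      rw [← hle, ← hle, hIJ.le_iff_lt, hIJ.symm.le_iff_lt]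
    · exact hYS I i'
    · exact hYS J i
    · have hii : i ≠ i' := fun h => hne (congrArg _ h)
      exact iff_of_true hii fun h => absurd (Sum.inl_injective h) hii

theorem theorem5p2 :
    (∀ m k : ℕ, 1 ≤ m + k →
      IsGraphAssociahedronOf (CubeHypersurface.graph m k) (cliqueWithLeaves m k)) ∧
    (∀ (l : ℕ) (n : Fin l → ℕ), 1 ≤ l → (∀ i, 1 ≤ n i) →
      IsGraphAssociahedronOf (ChainHypersurface.graph n) (cliqueWithPaths n)) :=
  ⟨fun _ _ hmk => CubeHypersurface.isGraphAssociahedronOf hmk,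
    fun _ _ hl hn => ChainHypersurface.isGraphAssociahedronOf hl hn⟩
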